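/- Let $\mathcal N=\omega^\omega$ be the Baire space. For functions $\mu,\nu$ defined on $\mathcal N$, write $\mu\le\nu$ if $\mu=\nu\circ f$ for some continuous $f:\mathcal N\to\mathcal N$. For a set $\mathcal A$ of open subsets of $\mathcal N$, let $\mathcal L^*(\mathcal A)$ (resp. $\mathcal L(\mathcal A)$) be the set of all maps $\nu:\mathcal N\to\mathcal A$ (resp. of all surjective maps $\nu:\mathcal N\to\mathcal A$) whose universal set $\{(a,x)\in\mathcal N\times\mathcal N : x\in\nu(a)\}$ is open. Let $L^*(\mathcal A)$ and $L(\mathcal A)$ be the quotient posets of these sets under the preorder $\le$, and let $L^*_\bot(\mathcal A)$ be $L^*(\mathcal A)$ with a new bottom element adjoined. A forest is a finite non-empty poset in which every lower cone $\{y : y\le x\}$ is a chain; a $k$-forest is a forest $F$ with a labeling $F\to\{0,\dots,k-1\}$. For $k$-forests write $F\le_h G$ if there is a monotone label-preserving map $F\to G$. Let $\mathbb F_k$ be the quotient poset of the $k$-forests under $\le_h$, let $e_i\in\mathbb F_k$ be the class of a singleton labeled $i$, and let $e=e_0\sqcup\dots\sqcup e_{k-1}$ be the class of the disjoint union of the $k$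 singletons labeled $0,\dots,k-1$. For a finite poset $P$, let the unfolding $F(P)$ be the forest of all non-empty sequences $(x_0,\dots,x_n)$ in $P$ with $x_0$ minimal and each $x_{j+1}$ an immediate successor of $x_j$, ordered by extension, and let $f:F(P)\to P$ map a sequence to its last entry. Let $\mathcal A$ be a finite non-empty set of open subsets of $\mathcal N$, let $k=|\mathcal A|$, let $c:\mathcal A\to\{0,\dots,k-1\}$ be any bijection, and let $a\in\mathbb F_k$ be the class of the unfolding $F(\mathcal A)$ of $(\mathcal A;\subseteq)$ with labeling $c\circ f$. Then: 1. $L^*(\mathcal A)$ is isomorphic to the principal ideal $\downarrow a=\{x\in\mathbb F_k : x\le a\}$, and $L(\mathcal A)$ is isomorphic to the interval $[e,a]=\{x\in\mathbb F_k : e\le x\le a\}$. 2. $L^*_\bot(\mathcal A)$ and $L(\mathcal A)$ are finite distributive lattices. 3. The isomorphism types of $L^*(\mathcal A)$ and $L(\mathcal A)$ are computable from the finite poset $(\mathcal A;\subseteq)$: there are algorithms that, given any presentation of $(\mathcal A;\subseteq)$ as a finite poset on an initial segment of the natural numbers, output such a presentation of a poset isomorphic to $L^*(\mathcal A)$, respectively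 to $L(\mathcal A)$. In particular, there are algorithms that decide, given presentations of $(\mathcal A;\subseteq)$ and $(\mathcal B;\subseteq)$ for finite non-empty sets $\mathcal A,\mathcal B$ of open subsets of $\mathcal N$, whether $L^*(\mathcal A)\simeq L^*(\mathcal B)$ and whether $L(\mathcal A)\simeq L(\mathcal B)$. -/

import Mathlib

namespace TotRep

/-! ### Total representations and reducibility on the Baire space -/

/-- The Baire space, with the product of the discrete topologies. -/
abbrev Baire : Type := ℕ → ℕ

/-- `μ ≤ ν` for total representations: `μ = ν ∘ f` for a continuous `f` on the Baire space. -/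
def Reducible {S : Type} (μ ν : Baire → S) : Prop :=
  ∃ f : Baire → Baire, Continuous f ∧ μ = ν ∘ f

theorem Reducible.refl {S : Type} (μ : Baire → S) : Reducible μ μ :=
  ⟨id, continuous_id, rfl⟩

theorem Reducible.trans {S : Type} {μ ν ξ : Baire → S}
    (h₁ : Reducible μ ν) (h₂ : Reducible ν ξ) : Reducible μ ξ := by
  obtain ⟨f, hf, rfl⟩ := h₁
  obtain ⟨g, hg, rfl⟩ := h₂
  exact ⟨g ∘ f, hg.comp hf, rfl⟩

/-- `ν` is a `Σ⁰₁`-total representation: its universal set `{(a, x) | x ∈ ν a}` is open. -/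
def IsOpenTR (ν : Baire → Set Baire) : Prop :=
  IsOpen {p : Baire × Baire | p.2 ∈ ν p.1}

/-- The `Σ⁰₁`-total representations of subsets of `A` (range contained in `A`). -/
structure SubRep (A : Set (Set Baire)) : Type where
  rep : Baire → Set Baire
  isOpenTR : IsOpenTR rep
  range_subset : Set.range rep ⊆ A

/-- The `Σ⁰₁`-total representations of `A` (range equal to `A`). -/
structure FullRep (A : Set (Set Baire)) : Type where
  rep : Baire → Set Baire
  isOpenTR : IsOpenTR rep
  range_eq : Set.range rep = A

instance (A : Set (Set Baire)) : Preorder (SubRep A) where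
  le μ ν := Reducible μ.rep ν.rep
  le_refl μ := Reducible.refl μ.rep
  le_trans _ _ _ h₁ h₂ := Reducible.trans h₁ h₂

instance (A : Set (Set Baire)) : Preorder (FullRep A) where
  le μ ν := Reducible μ.rep ν.rep
  le_refl μ := Reducible.refl μ.rep
  le_trans _ _ _ h₁ h₂ := Reducible.trans h₁ h₂

/-- `L*(A)`: the quotient poset of the preorder of representations of subsets of `A`. -/
abbrev LStar (A : Set (Set Baire)) : Type := Antisymmetrization (SubRep A) (· ≤ ·)

/-- `L(A)`: the quotient poset of the preorder of representations of `A`. -/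
abbrev LFull (A : Set (Set Baire)) : Type := Antisymmetrization (FullRep A) (· ≤ ·)

/-! ### Labeled forests -/

/-- A `k`-labeled forest: a finite non-empty poset in which every lower cone is a chain, with
a labeling by `0, …, k - 1`. -/
structure KForest (k : ℕ) : Type 1 where
  carrier : Type
  [order : PartialOrder carrier]
  [finite : Finite carrier]
  [nonempty : Nonempty carrier]
  chain_below : ∀ x y z : carrier, y ≤ x → z ≤ x → y ≤ z ∨ z ≤ y
  label : carrier → Fin k

attribute [instance] KForest.order KForest.finite KForest.nonempty

/-- The preorder `≤ₕ`: there is a monotone map that preserves the labels. -/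
instance (k : ℕ) : Preorder (KForest k) where
  le F G := ∃ f : F.carrier → G.carrier, Monotone f ∧ ∀ x, F.label x = G.label (f x)
  le_refl F := ⟨id, monotone_id, fun _ => rfl⟩
  le_trans _ _ _ h₁ h₂ := by
    obtain ⟨f, hf, hf'⟩ := h₁
    obtain ⟨g, hg, hg'⟩ := h₂
    exact ⟨g ∘ f, hg.comp hf, fun x => (hf' x).trans (hg' (f x))⟩

/-- The quotient poset `𝔽ₖ` of the `k`-labeled forests under `≤ₕ`. -/
abbrev ForestQuot (k : ℕ) : Type 1 := Antisymmetrization (KForest k) (· ≤ ·)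

/-- The `h`-equivalence class of a labeled forest. -/
def hClass {k : ℕ} (F : KForest k) : ForestQuot k := toAntisymmetrization (· ≤ ·) F

/-- The forest with a single element, labeled `i`. -/
def singletonForest {k : ℕ} (i : Fin k) : KForest k where
  carrier := Unit
  chain_below _ _ _ _ _ := Or.inl (le_refl _)
  label _ := i

/-- The disjoint union of the singleton forests labeled `0, …, k - 1` (elements of different
summands are incomparable in the order of the sigma type). -/
def singletonsForest (k : ℕ) [NeZero k] : KForest k where
  carrier := Σ _ : Fin k, Unit
  chain_below := by
    rintro _ _ _ ⟨i, a, b, -⟩ ⟨_, c, _, -⟩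
    exact Or.inl (Sigma.le_def.2 ⟨rfl, le_refl _⟩)
  label x := x.1

/-- The element `e = e₀ ⊔ ⋯ ⊔ eₖ₋₁` of `𝔽ₖ`. -/
def eClass (k : ℕ) [NeZero k] : ForestQuot k := hClass (singletonsForest k)

/-- `e` is indeed the supremum of the classes of the singleton forests. -/
theorem isLUB_eClass (k : ℕ) [NeZero k] :
    IsLUB (Set.range fun i : Fin k => hClass (singletonForest i)) (eClass k) := by
  constructor
  · rintro _ ⟨i, rfl⟩
    refine toAntisymmetrization_le_toAntisymmetrization_iff.2 ⟨fun _ => ⟨i, ()⟩, ?_, fun _ => rfl⟩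
    intro _ _ _
    exact le_refl _
  · intro b hb
    induction b using Quotient.inductionOn with
    | h F =>
      have h : ∀ i : Fin k, ∃ x : F.carrier, i = F.label x := by
        intro i
        obtain ⟨f, -, hf⟩ :=
          toAntisymmetrization_le_toAntisymmetrization_iff.1 (hb ⟨i, rfl⟩)
        exact ⟨f (), hf ()⟩
      choose g hg using h
      refine toAntisymmetrization_le_toAntisymmetrization_iff.2
        ⟨fun x => g x.1, ?_, fun x => hg x.1⟩
      rintro _ _ ⟨i, a, b, -⟩
      exact le_refl _

/-! ### The unfolding of a finite poset -/

/-- An element of the bottom-up unfolding `F(P)` of a poset `P`: a non-empty sequence of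
elements of `P` that starts at a minimal element and in which every entry is an immediate
successor of the entry before it. -/
structure Path (P : Type) [PartialOrder P] : Type where
  toList : List P
  ne_nil : toList ≠ []
  isMin_head : IsMin (toList.head ne_nil)
  isChain : toList.IsChain (· ⋖ ·)

namespace Path

variable {P : Type} [PartialOrder P]

theorem toList_injective : Function.Injective (Path.toList (P := P)) := by
  rintro ⟨l, _, _, _⟩ ⟨l', _, _, _⟩ h
  cases h
  rfl

/-- Paths are ordered by extension. -/
instance : PartialOrder (Path P) where
  le p q := p.toList <+: q.toList
  le_refl p := List.prefix_refl p.toList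
  le_trans _ _ _ h₁ h₂ := List.IsPrefix.trans h₁ h₂
  le_antisymm _ _ h₁ h₂ := toList_injective (h₁.eq_of_length_le h₂.length_le)

/-- The map `f : F(P) → P`: the endpoint of a path. -/
def last (p : Path P) : P := p.toList.getLast p.ne_nil

theorem nodup (p : Path P) : p.toList.Nodup := by
  have h : p.toList.IsChain (· < ·) := p.isChain.imp fun _ _ h => h.lt
  exact (List.isChain_iff_pairwise.1 h).imp fun h => h.ne

instance [Finite P] : Finite (Path P) := by
  classical
  cases nonempty_fintype P
  exact Finite.of_injective
    (fun p : Path P => (⟨p.toList, p.nodup⟩ : {l : List P // l.Nodup}))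
    fun p q h => toList_injective (congrArg Subtype.val h)

instance [Finite P] [Nonempty P] : Nonempty (Path P) := by
  obtain ⟨m, hm⟩ := Set.finite_univ.exists_minimal (Set.univ_nonempty (α := P))
  exact ⟨⟨[m], by simp, fun x hx => hm.2 trivial hx, by simp⟩⟩

end Path

/-- The labeled forest `(F(P); c ∘ f)` obtained by unfolding a finite poset `P` labeled
by `c`. -/
def unfolding {P : Type} [PartialOrder P] [Finite P] [Nonempty P] {k : ℕ} (c : P → Fin k) :
    KForest k where
  carrier := Path P
  chain_below _ _ _ hy hz := List.prefix_or_prefix_of_prefix hy hz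
  label p := c p.last

/-! ### Finite distributive lattices and codes of finite posets -/

/-- The poset `X` is a finite (non-empty) distributive lattice. -/
def IsFiniteDistribLattice (X : Type) [PartialOrder X] : Prop :=
  Finite X ∧ Nonempty X ∧ ∃ (Y : Type) (_ : DistribLattice Y), Nonempty (X ≃o Y)

/-- Codes of finite posets: a size `n` and a list of pairs of numbers. -/
abbrev PosetCode : Type := ℕ × List (ℕ × ℕ)

/-- The code `(n, r)` presents the poset `X`: up to a bijection of `{0, …, n - 1}` with `X`, the
order of `X` is the list `r`. -/
def Presents (p : PosetCode) (X : Type) [PartialOrder X] : Prop :=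
  ∃ e : Fin p.1 ≃ X, ∀ i j : Fin p.1, e i ≤ e j ↔ ((i : ℕ), (j : ℕ)) ∈ p.2

end TotRep

open TotRep

/-! Both posets in the theorem consist of labeled spaces. Since `A` is finite with open members, a
map into `A` has open universal set iff its values increase locally (`isOpenTR_iff`). A labeled
forest lies below the unfolding of `A` iff its labels increase along the order (`le_unfolding_iff`),
which is the same condition for the topology of upper sets on the forest.

A labeled space has a finite invariant. A tree is realized at a point `a` if `a` has the root label
and every immediate subtree is realized arbitrarily close to `a`. Only the finitely many reduced
trees matter: labels increase strictly and siblings are distinct. The set of realized reduced trees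
is closed downwards under the homomorphic order `TLe`.

This set determines the space up to reducibility. A continuous label-preserving map sends
realizations to realizations. Conversely, the trees realized near a point `a` have a greatest one,
`topTree`, and the set of them (the germ of `a`) can only shrink when `a` moves slightly. If the
target realizes all these trees, the sets of admissible images are non-empty and vary lower
semicontinuously, and a selection gives the reduction: `exists_continuous_selection` on the Baire
space, `exists_monotone_selection` on forests. Every non-empty lower set of reduced trees occurs, by
walking down subtrees along a point of the Baire space or by unfolding the descendant order of the
set.

Hence `L*(A)` and the ideal below `a` are both the poset of non-empty lower sets of reduced trees;
`L(A)` and `[e, a]` are both the poset of lower sets containing all one-node trees. Lower sets are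
closed under union and intersection, whence distributivity, and the new bottom is the empty set. The
trees and their order are computed from a presentation of `A` by bounded search. -/

namespace TotRep

open Filter Topology

/-! ### Tree codes -/

/-- The label at the root of the tree coded by `t`. -/
def root (t : ℕ) : ℕ := t.unpair.1

/-- The codes of the immediate subtrees of the tree coded by `t`. -/
def children (t : ℕ) : List ℕ := Denumerable.ofNat (List ℕ) t.unpair.2

/-- The code of the tree with root label `i` and immediate subtrees `S`. -/
def node (i : ℕ) (S : List ℕ) : ℕ := Nat.pair i (Encodable.encode S)

@[simp] theorem root_node (i : ℕ) (S : List ℕ) : root (node i S) = i := by simp [root, node]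

@[simp] theorem children_node (i : ℕ) (S : List ℕ) : children (node i S) = S := by
  simp [children, node]

@[simp] theorem node_root_children (t : ℕ) : node (root t) (children t) = t := by
  simp [root, children, node]

theorem node_injective (i : ℕ) : Function.Injective (node i) := fun S T h => by
  simpa using congrArg children h

theorem lt_encode_of_mem {s : ℕ} {l : List ℕ} (h : s ∈ l) : s < Encodable.encode l := by
  induction l with
  | nil => simp at h
  | cons a l ih =>
    rw [Encodable.encode_list_cons, Encodable.encode_nat]
    rcases List.mem_cons.1 h with rfl | h
    · exact Nat.lt_succ_of_le (Nat.left_le_pair _ _)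
    · exact Nat.lt_succ_of_le ((ih h).le.trans (Nat.right_le_pair _ _))

theorem lt_of_mem_children {s t : ℕ} (h : s ∈ children t) : s < t := by
  have := lt_encode_of_mem h
  rw [children, Denumerable.encode_ofNat] at this
  exact this.trans_le (Nat.unpair_right_le t)

/-- The homomorphic order on tree codes: the tree `t` maps to the tree `t'` by a monotone
label-preserving map. -/
inductive TLe : ℕ → ℕ → Prop
  | root {t t' : ℕ} : root t = root t' → (∀ s ∈ children t, TLe s t') → TLe t t'
  | child {t t' s : ℕ} : s ∈ children t' → TLe t s → TLe t t'

theorem TLe.refl (t : ℕ) : TLe t t := by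
  induction t using Nat.strong_induction_on with
  | h t ih => exact .root rfl fun s hs => .child hs (ih s (lt_of_mem_children hs))

theorem tle_iff {t t' : ℕ} : TLe t t' ↔
    (root t = root t' ∧ ∀ s ∈ children t, TLe s t') ∨ ∃ s ∈ children t', TLe t s := by
  constructor
  · rintro (⟨h, h'⟩ | ⟨h, h'⟩)
    exacts [.inl ⟨h, h'⟩, .inr ⟨_, h, h'⟩]
  · rintro (⟨h, h'⟩ | ⟨s, h, h'⟩)
    exacts [.root h h', .child h h']

/-! ### Realizations of trees in labeled spaces -/

section Realize

variable {X Y : Type*} [TopologicalSpace X] [TopologicalSpace Y]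

/-- The set of the points of a labeled space at which the tree coded by `t` is realized. -/
def realize (ν : X → ℕ) (t : ℕ) : Set X :=
  {a | ν a = root t ∧ ∀ s, ∀ _ : s ∈ children t, a ∈ closure (realize ν s)}
termination_by t
decreasing_by exact lt_of_mem_children ‹_›

theorem mem_realize {ν : X → ℕ} {t : ℕ} {a : X} : a ∈ realize ν t ↔
    ν a = root t ∧ ∀ s ∈ children t, a ∈ closure (realize ν s) := by
  rw [realize]; rfl

/-- Subtrees of a realized tree are realized nearby, and by idempotence of closure so are their
subtrees; hence moving to a smaller tree costs only a closure. -/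
theorem TLe.realize_subset {ν : X → ℕ} {t t' : ℕ} (h : TLe t t') :
    realize ν t' ⊆ closure (realize ν t) := by
  induction h with
  | root h _ ih =>
    intro a ha
    exact subset_closure (mem_realize.2 ⟨(mem_realize.1 ha).1.trans h.symm, fun s hs => ih s hs ha⟩)
  | child h _ ih =>
    intro a ha
    exact closure_minimal ih isClosed_closure ((mem_realize.1 ha).2 _ h)

theorem realize_comp_subset {μ : Y → ℕ} {f : X → Y} (hf : Continuous f) (t : ℕ) :
    realize (μ ∘ f) t ⊆ f ⁻¹' realize μ t := by
  induction t using Nat.strong_induction_on with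
  | h t ih =>
    intro a ha
    rw [mem_realize] at ha
    refine mem_realize.2 ⟨ha.1, fun s hs => ?_⟩
    exact closure_minimal ((ih s (lt_of_mem_children hs)).trans (Set.preimage_mono subset_closure))
      (isClosed_closure.preimage hf) (ha.2 s hs)

/-- If a map `u` to tree codes locally moves to descendants, and reaches every child arbitrarily
close by, then the trees realized near `a` are those below `u a`. -/
theorem mem_closure_realize_root_comp {u : X → ℕ}
    (h₁ : ∀ a, ∀ᶠ b in 𝓝 a, Relation.ReflTransGen (fun x y => y ∈ children x) (u a) (u b))
    (h₂ : ∀ a, ∀ s ∈ children (u a), a ∈ closure (u ⁻¹' {s})) (t : ℕ) (a : X) :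
    a ∈ closure (realize (root ∘ u) t) ↔ TLe t (u a) := by
  have hdesc : ∀ {t x y}, Relation.ReflTransGen (fun x y => y ∈ children x) x y →
      TLe t y → TLe t x := by
    intro t x y hxy hty
    induction hxy using Relation.ReflTransGen.head_induction_on with
    | refl => exact hty
    | head h _ ih => exact .child h ih
  constructor
  · induction t using Nat.strong_induction_on generalizing a with
    | h t ih =>
      intro ha
      -- Near `a` there is a point realizing `t` whose tree descends from `u a`; comparing `t` with
      -- the tree at that point suffices.
      obtain ⟨b, hb, hbt⟩ := mem_closure_iff_nhds.1 ha _ (h₁ a)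
      refine hdesc hb ?_
      rw [mem_realize] at hbt
      exact .root hbt.1.symm fun s hs => ih s (lt_of_mem_children hs) b (hbt.2 s hs)
  · intro h
    generalize hx : u a = x at h
    induction h generalizing a with
    | root h _ ih =>
      exact subset_closure (mem_realize.2 ⟨by simp [hx, h], fun s hs => ih s hs a hx⟩)
    | @child _ _ s h _ ih =>
      exact closure_minimal (s := u ⁻¹' {s}) (fun b hb => ih b hb) isClosed_closure
        (h₂ a s (hx ▸ h))

end Realize

/-! ### The finite list of reduced trees over a coded poset -/

/-- The strict order of the poset coded by `p`. -/
def SLt (p : PosetCode) (i j : ℕ) : Prop := (i, j) ∈ p.2 ∧ i ≠ j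

instance (p : PosetCode) (i j : ℕ) : Decidable (SLt p i j) := by unfold SLt; infer_instance

/-- The number of the elements strictly above `i`. -/
def corank (p : PosetCode) (i : ℕ) : ℕ := ((List.range p.1).filter fun j => SLt p i j).length

/-- The trees of the list `L` with root label strictly above `i`. -/
def above (p : PosetCode) (L : List ℕ) (i : ℕ) : List ℕ := L.filter fun t => SLt p i (root t)

/-- The trees all of whose root labels have corank less than the given number. -/
def treesBelow (p : PosetCode) : ℕ → List ℕ
  | 0 => []
  | h + 1 => treesBelow p h ++ ((List.range p.1).filter fun i => corank p i = h).flatMap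
      fun i => (above p (treesBelow p h) i).sublists'.map (node i)

/-- The trees with labels increasing strictly and, at every node, a sublist of subtrees. -/
def trees (p : PosetCode) : List ℕ := treesBelow p p.1

/-- The relation of the code `p` is a partial order of `{0, …, p.1 - 1}`. -/
structure PosetCode.Valid (p : PosetCode) : Prop where
  refl : ∀ i < p.1, (i, i) ∈ p.2
  trans : ∀ i < p.1, ∀ j < p.1, ∀ l < p.1, (i, j) ∈ p.2 → (j, l) ∈ p.2 → (i, l) ∈ p.2
  antisymm : ∀ i < p.1, ∀ j < p.1, (i, j) ∈ p.2 → (j, i) ∈ p.2 → i = j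

theorem Presents.valid {p : PosetCode} {P : Type} [PartialOrder P] (h : Presents p P) :
    p.Valid := by
  obtain ⟨e, he⟩ := h
  refine ⟨fun i hi => (he ⟨i, hi⟩ ⟨i, hi⟩).1 le_rfl, fun i hi j hj l hl h₁ h₂ => ?_,
    fun i hi j hj h₁ h₂ => ?_⟩
  · exact (he ⟨i, hi⟩ ⟨l, hl⟩).1 (((he ⟨i, hi⟩ ⟨j, hj⟩).2 h₁).trans ((he ⟨j, hj⟩ ⟨l, hl⟩).2 h₂))
  · have := ((he ⟨i, hi⟩ ⟨j, hj⟩).2 h₁).antisymm ((he ⟨j, hj⟩ ⟨i, hi⟩).2 h₂)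
    simpa using this

/-- The element `i` does not count itself, so `p.1` stages of `treesBelow` exhaust all roots. -/
theorem corank_lt (p : PosetCode) {i : ℕ} (hi : i < p.1) : corank p i < p.1 := by
  have : corank p i < (List.range p.1).length := by
    refine List.length_filter_lt_length_iff_exists.2 ⟨i, by simpa using hi, by simp [SLt]⟩
  simpa using this

/-- By transitivity everything above `j` is above `i`, and `j` itself is lost in the count. -/
theorem corank_lt_corank {p : PosetCode} (hp : p.Valid) {i j : ℕ} (hi : i < p.1) (hj : j < p.1)
    (h : SLt p i j) : corank p j < corank p i := by
  have h₁ : ((List.range p.1).filter fun l => SLt p j l) =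
      (((List.range p.1).filter fun l => SLt p i l).filter fun l => SLt p j l) := by
    rw [List.filter_filter]
    refine List.filter_congr fun l hl => ?_
    have hl : l < p.1 := by simpa using hl
    have : SLt p j l → SLt p i l := fun h' =>
      ⟨hp.trans i hi j hj l hl h.1 h'.1, fun e => h.2 (hp.antisymm i hi j hj h.1 (e ▸ h'.1))⟩
    by_cases h' : SLt p j l <;> simp [h', this]
  rw [corank, h₁]
  refine List.length_filter_lt_length_iff_exists.2 ⟨j, ?_, by simp [SLt]⟩
  simpa [hj] using h

theorem mem_above {p : PosetCode} {L : List ℕ} {i t : ℕ} :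
    t ∈ above p L i ↔ t ∈ L ∧ SLt p i (root t) := by simp [above]

theorem mem_treesBelow {p : PosetCode} {h t : ℕ} : t ∈ treesBelow p h ↔
    root t < p.1 ∧ corank p (root t) < h ∧
      (children t).Sublist (above p (treesBelow p (corank p (root t))) (root t)) := by
  induction h with
  | zero => simp [treesBelow]
  | succ h ih =>
    simp only [treesBelow, List.mem_append, ih, List.mem_flatMap, List.mem_filter, List.mem_range,
      decide_eq_true_eq, List.mem_map, List.mem_sublists']
    constructor
    · rintro (⟨h₁, h₂, h₃⟩ | ⟨i, ⟨h₁, rfl⟩, S, h₃, rfl⟩)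
      · exact ⟨h₁, by omega, h₃⟩
      · simpa using ⟨h₁, h₃⟩
    · rintro ⟨h₁, h₂, h₃⟩
      rcases Nat.lt_succ_iff_lt_or_eq.1 h₂ with h₂ | rfl
      · exact .inl ⟨h₁, h₂, h₃⟩
      · exact .inr ⟨root t, ⟨h₁, rfl⟩, children t, h₃, by simp⟩

/-- A root above `i` has smaller corank, so its trees have all been listed by stage `corank p i`.
This is why the recursive list satisfies the stage-free description in `mem_trees`. -/
theorem above_treesBelow_eq {p : PosetCode} (hp : p.Valid) {i h : ℕ} (hi : i < p.1)
    (h' : corank p i ≤ h) :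
    above p (treesBelow p h) i = above p (treesBelow p (corank p i)) i := by
  induction h, h' using Nat.le_induction with
  | base => rfl
  | succ h h' ih =>
    rw [← ih]
    simp only [above, treesBelow, List.filter_append]
    refine (congrArg _ (List.filter_eq_nil_iff.2 fun t ht => ?_)).trans (List.append_nil _)
    simp only [List.mem_flatMap, List.mem_filter, List.mem_range, decide_eq_true_eq,
      List.mem_map] at ht
    obtain ⟨j, ⟨hj, hj'⟩, S, -, rfl⟩ := ht
    have := corank_lt_corank hp hi hj
    simp only [root_node, decide_eq_true_eq]
    intro hij
    have := this hij
    omega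

theorem mem_trees {p : PosetCode} (hp : p.Valid) {t : ℕ} : t ∈ trees p ↔
    root t < p.1 ∧ (children t).Sublist (above p (trees p) (root t)) := by
  rw [trees, mem_treesBelow]
  refine and_congr_right fun h => ?_
  rw [above_treesBelow_eq hp h (corank_lt p h).le]
  exact and_iff_right (corank_lt p h)

theorem nodup_treesBelow (p : PosetCode) (h : ℕ) : (treesBelow p h).Nodup := by
  induction h with
  | zero => simp [treesBelow]
  | succ h ih =>
    rw [treesBelow, List.nodup_append']
    refine ⟨ih, List.nodup_flatMap.2 ⟨fun i _ => ?_, ?_⟩, ?_⟩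
    · exact (List.nodup_sublists'.2 (ih.filter _)).map (node_injective i)
    · refine (List.nodup_range.filter _).imp fun {i j} hij => ?_
      simp only [Function.onFun, List.disjoint_left, List.mem_map, not_exists, not_and]
      rintro _ ⟨S, -, rfl⟩ T - h
      exact hij (by simpa using (congrArg root h).symm)
    · rw [List.disjoint_left]
      intro t ht ht'
      simp only [List.mem_flatMap, List.mem_filter, List.mem_range, decide_eq_true_eq,
        List.mem_map] at ht'
      obtain ⟨j, ⟨hj, hj'⟩, S, -, rfl⟩ := ht'
      have := (mem_treesBelow.1 ht).2.1
      simp at this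
      omega

theorem nodup_trees (p : PosetCode) : (trees p).Nodup := nodup_treesBelow p p.1

theorem mem_trees_of_mem_children {p : PosetCode} (hp : p.Valid) {s t : ℕ} (ht : t ∈ trees p)
    (hs : s ∈ children t) : s ∈ trees p ∧ SLt p (root t) (root s) :=
  mem_above.1 (((mem_trees hp).1 ht).2.subset hs)

/-! ### Labelings that increase locally -/

section Labeling

variable {X Y : Type*} [TopologicalSpace X] [TopologicalSpace Y] {p : PosetCode}

/-- The labeling `ν` takes values in the poset coded by `p` and is continuous for the topology of
the upper sets. -/
structure IsLabeling (p : PosetCode) (ν : X → ℕ) : Prop where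
  lt : ∀ a, ν a < p.1
  eventually_le : ∀ a, ∀ᶠ b in 𝓝 a, (ν a, ν b) ∈ p.2

/-- The reduced trees that are realized in a labeled space. -/
def realized (p : PosetCode) (ν : X → ℕ) : Set ℕ := {t | t ∈ trees p ∧ (realize ν t).Nonempty}

/-- The reduced trees that are realized arbitrarily close to `a`. -/
def germ (p : PosetCode) (ν : X → ℕ) (a : X) : Set ℕ :=
  {t | t ∈ trees p ∧ a ∈ closure (realize ν t)}

open Classical in
/-- The largest reduced tree realized arbitrarily close to `a`. -/
noncomputable def topTree (p : PosetCode) (ν : X → ℕ) (a : X) : ℕ :=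
  node (ν a) ((above p (trees p) (ν a)).filter (· ∈ germ p ν a))

variable {ν : X → ℕ}

theorem root_topTree (a : X) : root (topTree p ν a) = ν a := root_node _ _

theorem mem_children_topTree {a : X} {s : ℕ} :
    s ∈ children (topTree p ν a) ↔ s ∈ germ p ν a ∧ SLt p (ν a) (root s) := by
  simp only [topTree, children_node, List.mem_filter, mem_above, decide_eq_true_eq]
  exact ⟨fun h => ⟨h.2, h.1.2⟩, fun h => ⟨⟨h.1.1, h.2⟩, h.1⟩⟩

theorem mem_realize_topTree (a : X) : a ∈ realize ν (topTree p ν a) :=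
  mem_realize.2 ⟨(root_topTree a).symm, fun _ hs => (mem_children_topTree.1 hs).1.2⟩

theorem IsLabeling.topTree_mem_trees (hp : p.Valid) (hν : IsLabeling p ν) (a : X) :
    topTree p ν a ∈ trees p :=
  (mem_trees hp).2 (by
    rw [root_topTree, topTree, children_node]
    exact ⟨hν.lt a, List.filter_sublist⟩)

theorem IsLabeling.topTree_mem_germ (hp : p.Valid) (hν : IsLabeling p ν) (a : X) :
    topTree p ν a ∈ germ p ν a :=
  ⟨hν.topTree_mem_trees hp a, subset_closure (mem_realize_topTree a)⟩

theorem IsLabeling.le_root_of_mem_germ (hν : IsLabeling p ν) {a : X} {t : ℕ}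
    (h : t ∈ germ p ν a) : (ν a, root t) ∈ p.2 := by
  obtain ⟨b, hb, hbt⟩ := mem_closure_iff_nhds.1 h.2 _ (hν.eventually_le a)
  exact (mem_realize.1 hbt).1 ▸ hb

/-- A germ tree whose root label is strictly larger is itself a child of the top tree. If the root
label equals that of `a`, its immediate subtrees are again in the germ and have larger roots, so
they are children of the top tree. -/
theorem IsLabeling.tle_topTree (hp : p.Valid) (hν : IsLabeling p ν) {a : X} {t : ℕ}
    (h : t ∈ germ p ν a) : TLe t (topTree p ν a) := by
  by_cases ht : ν a = root t
  · refine .root (by rw [root_topTree, ht]) fun s hs => ?_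
    refine .child (mem_children_topTree.2 ?_) (TLe.refl s)
    obtain ⟨h₁, h₂⟩ := mem_trees_of_mem_children hp h.1 hs
    exact ⟨⟨h₁, closure_minimal (fun b hb => (mem_realize.1 hb).2 s hs) isClosed_closure h.2⟩,
      ht ▸ h₂⟩
  · exact .child (mem_children_topTree.2 ⟨h, hν.le_root_of_mem_germ h, ht⟩) (TLe.refl t)

/-- The germ determines the label: the top tree is in the germ, and all roots in the germ lie above
the label. So sets chosen through top trees depend on the germ alone. -/
theorem IsLabeling.topTree_eq (hp : p.Valid) (hν : IsLabeling p ν) {a b : X}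
    (h : germ p ν a = germ p ν b) : topTree p ν a = topTree p ν b := by
  have key : ∀ {a b : X}, germ p ν a = germ p ν b → (ν a, ν b) ∈ p.2 := fun {a b} h => by
    have := hν.le_root_of_mem_germ (h ▸ hν.topTree_mem_germ hp b : topTree p ν b ∈ germ p ν a)
    rwa [root_topTree] at this
  have : ν a = ν b := hp.antisymm _ (hν.lt a) _ (hν.lt b) (key h) (key h.symm)
  rw [topTree, topTree, h, this]

/-- Each tree missing from the germ is excluded on the open complement of a closure, and there are
finitely many trees. -/
theorem eventually_germ_subset (p : PosetCode) (ν : X → ℕ) (a : X) :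
    ∀ᶠ b in 𝓝 a, germ p ν b ⊆ germ p ν a := by
  have : ∀ᶠ b in 𝓝 a, ∀ t ∈ (trees p).toFinset, b ∈ closure (realize ν t) →
      a ∈ closure (realize ν t) := by
    rw [Filter.eventually_all_finset]
    intro t _
    by_cases h : a ∈ closure (realize ν t)
    · simp [h]
    · filter_upwards [isClosed_closure.isOpen_compl.mem_nhds h] with b hb hb'
      exact absurd hb' hb
  filter_upwards [this] with b hb t ht
  exact ⟨ht.1, hb t (by simpa using ht.1) ht.2⟩

/-- The points of `Y` at which the trees of the points of `X` with germ `S` are realized. -/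
def germRealize (p : PosetCode) (ν : X → ℕ) (μ : Y → ℕ) (S : Set ℕ) : Set Y :=
  {y | ∃ a, germ p ν a = S ∧ y ∈ realize μ (topTree p ν a)}

variable {μ : Y → ℕ}

theorem IsLabeling.germRealize_germ (hp : p.Valid) (hν : IsLabeling p ν) (a : X) :
    germRealize p ν μ (germ p ν a) = realize μ (topTree p ν a) := by
  ext y
  constructor
  · rintro ⟨b, hb, hy⟩
    rwa [hν.topTree_eq hp hb] at hy
  · exact fun hy => ⟨a, rfl, hy⟩

theorem IsLabeling.germRealize_nonempty (hp : p.Valid) (hν : IsLabeling p ν)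
    (h : realized p ν ⊆ realized p μ) (a : X) : (germRealize p ν μ (germ p ν a)).Nonempty := by
  rw [hν.germRealize_germ hp]
  exact (h ⟨hν.topTree_mem_trees hp a, a, mem_realize_topTree a⟩).2

/-- The top tree at `b` belongs to the germ at `a`, hence lies below the top tree at `a`. This is
the lower semicontinuity that the selection arguments need. -/
theorem IsLabeling.germRealize_subset (hp : p.Valid) (hν : IsLabeling p ν) {a b : X}
    (h : germ p ν b ⊆ germ p ν a) :
    germRealize p ν μ (germ p ν a) ⊆ closure (germRealize p ν μ (germ p ν b)) := by
  rw [hν.germRealize_germ hp, hν.germRealize_germ hp]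
  exact (hν.tle_topTree hp (h (hν.topTree_mem_germ hp b))).realize_subset

theorem IsLabeling.eq_of_mem_germRealize {a : X} {y : Y} (hp : p.Valid) (hν : IsLabeling p ν)
    (h : y ∈ germRealize p ν μ (germ p ν a)) : ν a = μ y := by
  rw [hν.germRealize_germ hp] at h
  rw [(mem_realize.1 h).1, root_topTree]

theorem realized_comp_subset {f : X → Y} (hf : Continuous f) :
    realized p (μ ∘ f) ⊆ realized p μ := fun t ⟨ht, a, ha⟩ =>
  ⟨ht, f a, realize_comp_subset hf t ha⟩

theorem realized_lower {s t : ℕ} (hs : s ∈ trees p) (h : TLe s t) (ht : t ∈ realized p ν) :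
    s ∈ realized p ν := by
  obtain ⟨a, ha⟩ := ht.2
  exact ⟨hs, closure_nonempty_iff.1 ⟨a, h.realize_subset ha⟩⟩

theorem IsLabeling.realized_nonempty [Nonempty X] (hp : p.Valid) (hν : IsLabeling p ν) :
    (realized p ν).Nonempty := by
  obtain ⟨a⟩ := ‹Nonempty X›
  exact ⟨_, hν.topTree_mem_trees hp a, a, mem_realize_topTree a⟩

theorem node_nil_mem_trees (hp : p.Valid) {i : ℕ} (hi : i < p.1) : node i [] ∈ trees p :=
  (mem_trees hp).2 (by simpa using hi)

/-- One-node trees detect the range of a labeling, so surjectivity is visible in the invariant. -/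
theorem node_nil_mem_realized (hp : p.Valid) {i : ℕ} (hi : i < p.1) :
    node i [] ∈ realized p ν ↔ i ∈ Set.range ν := by
  constructor
  · rintro ⟨-, a, ha⟩
    exact ⟨a, by simpa using (mem_realize.1 ha).1⟩
  · rintro ⟨a, rfl⟩
    exact ⟨node_nil_mem_trees hp hi, a, mem_realize.2 (by simp)⟩

end Labeling

/-! ### Lower sets of reduced trees -/

/-- The sets of reduced trees that are closed downwards. -/
def lowerTrees (p : PosetCode) : Sublattice (Set ℕ) where
  carrier := {S | S ⊆ {t | t ∈ trees p} ∧ ∀ t ∈ S, ∀ s ∈ trees p, TLe s t → s ∈ S}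
  supClosed' := by
    rintro S ⟨h₁, h₂⟩ T ⟨h₃, h₄⟩
    refine ⟨Set.union_subset h₁ h₃, ?_⟩
    rintro t (ht | ht) s hs hst
    exacts [.inl (h₂ t ht s hs hst), .inr (h₄ t ht s hs hst)]
  infClosed' := by
    rintro S ⟨h₁, h₂⟩ T ⟨h₃, h₄⟩
    exact ⟨Set.inter_subset_left.trans h₁, fun t ht s hs hst =>
      ⟨h₂ t ht.1 s hs hst, h₄ t ht.2 s hs hst⟩⟩

/-- The downward closed sets of reduced trees in which every label occurs. -/
def fullLowerTrees (p : PosetCode) : Sublattice (Set ℕ) where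
  carrier := {S | S ∈ lowerTrees p ∧ ∀ i < p.1, node i [] ∈ S}
  supClosed' := fun _ hS _ hT => ⟨(lowerTrees p).supClosed hS.1 hT.1, fun i hi => .inl (hS.2 i hi)⟩
  infClosed' := fun _ hS _ hT => ⟨(lowerTrees p).infClosed hS.1 hT.1,
    fun i hi => ⟨hS.2 i hi, hT.2 i hi⟩⟩

theorem IsLabeling.realized_mem_lowerTrees {X : Type*} [TopologicalSpace X] {p : PosetCode}
    {ν : X → ℕ} : realized p ν ∈ lowerTrees p :=
  ⟨fun _ h => h.1, fun _ ht _ hs h => realized_lower hs h ht⟩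

theorem realized_root_comp {X : Type*} [TopologicalSpace X] {p : PosetCode} {u : X → ℕ}
    {S : Set ℕ} (hS : S ∈ lowerTrees p) (hu : Set.range u = S)
    (h₁ : ∀ a, ∀ᶠ b in 𝓝 a, Relation.ReflTransGen (fun x y => y ∈ children x) (u a) (u b))
    (h₂ : ∀ a, ∀ s ∈ children (u a), a ∈ closure (u ⁻¹' {s})) :
    realized p (root ∘ u) = S := by
  ext t
  constructor
  · rintro ⟨ht, a, ha⟩
    exact hS.2 (u a) (hu ▸ ⟨a, rfl⟩) t ht
      ((mem_closure_realize_root_comp h₁ h₂ t a).1 (subset_closure ha))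
  · intro ht
    obtain ⟨a, rfl⟩ : t ∈ Set.range u := hu ▸ ht
    exact ⟨hS.1 ht, closure_nonempty_iff.1
      ⟨a, (mem_closure_realize_root_comp h₁ h₂ _ a).2 (TLe.refl _)⟩⟩

theorem isLabeling_root_comp {X : Type*} [TopologicalSpace X] {p : PosetCode} (hp : p.Valid)
    {u : X → ℕ} (hu : ∀ a, u a ∈ trees p)
    (h₁ : ∀ a, ∀ᶠ b in 𝓝 a, Relation.ReflTransGen (fun x y => y ∈ children x) (u a) (u b)) :
    IsLabeling p (root ∘ u) := by
  refine ⟨fun a => ((mem_trees hp).1 (hu a)).1, fun a => (h₁ a).mono fun b hb => ?_⟩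
  have : ∀ {x y}, x ∈ trees p → Relation.ReflTransGen (fun x y => y ∈ children x) x y →
      y ∈ trees p ∧ (root x, root y) ∈ p.2 := by
    intro x y hx hxy
    induction hxy with
    | refl => exact ⟨hx, hp.refl _ ((mem_trees hp).1 hx).1⟩
    | tail _ h ih =>
      obtain ⟨h₃, h₄⟩ := mem_trees_of_mem_children hp ih.1 h
      exact ⟨h₃, hp.trans _ ((mem_trees hp).1 hx).1 _ ((mem_trees hp).1 ih.1).1 _
        ((mem_trees hp).1 h₃).1 ih.2 h₄.1⟩
  exact (this (hu a) hb).2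

end TotRep

namespace TotRep

open Filter Topology

/-! ### Selections in the Baire space -/

/-- The cylinder of the points that agree with `a` in the first `n` coordinates. -/
abbrev cyl (a : Baire) (n : ℕ) : Set Baire := PiNat.cylinder (E := fun _ => ℕ) a n

theorem cyl_eq {a b : Baire} {n : ℕ} (h : b ∈ cyl a n) : cyl b n = cyl a n :=
  PiNat.mem_cylinder_iff_eq.1 h

theorem cyl_mem_nhds (a : Baire) (n : ℕ) : cyl a n ∈ 𝓝 a :=
  (PiNat.isOpen_cylinder _ a n).mem_nhds (PiNat.self_mem_cylinder a n)

theorem mem_nhds_baire {a : Baire} {s : Set Baire} : s ∈ 𝓝 a ↔ ∃ n, cyl a n ⊆ s := by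
  refine ⟨fun h => ?_, fun ⟨n, hn⟩ => mem_of_superset (cyl_mem_nhds a n) hn⟩
  obtain ⟨_, ⟨x, n, rfl⟩, ha, hs⟩ :=
    (PiNat.isTopologicalBasis_cylinders fun _ => ℕ).mem_nhds_iff.1 h
  exact ⟨n, (cyl_eq ha).trans_subset hs⟩

theorem mem_closure_baire {a : Baire} {s : Set Baire} :
    a ∈ closure s ↔ ∀ n, (cyl a n ∩ s).Nonempty := by
  rw [mem_closure_iff_nhds]
  refine ⟨fun h n => h _ (cyl_mem_nhds a n), fun h t ht => ?_⟩
  obtain ⟨n, hn⟩ := mem_nhds_baire.1 ht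
  exact (h n).mono (Set.inter_subset_inter_left _ hn)

section Guess

variable {K : Type*} (M : K → Set Baire)

open Classical in
/-- Change the current guess for a value of `h` and a point with that value to the value `k`,
keeping the first `n` coordinates of the point if possible. -/
noncomputable def nextGuess (n : ℕ) (s : K × Baire) (k : K) : K × Baire :=
  if k = s.1 then s
  else if H : (cyl s.2 n ∩ M k).Nonempty then (k, H.some)
  else if H : (M k).Nonempty then (k, H.some) else s

variable {M}

theorem nextGuess_fst {n : ℕ} {s : K × Baire} {k : K} (hk : (M k).Nonempty) :
    (nextGuess M n s k).1 = k := by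
  unfold nextGuess
  split_ifs with h₁ h₂
  exacts [h₁.symm, rfl, rfl]

theorem nextGuess_mem {n : ℕ} {s : K × Baire} {k : K} (hk : (M k).Nonempty) (hs : s.2 ∈ M s.1) :
    (nextGuess M n s k).2 ∈ M k := by
  unfold nextGuess
  split_ifs with h₁ h₂
  exacts [h₁ ▸ hs, h₂.some_mem.2, hk.some_mem]

theorem nextGuess_mem_cyl {n : ℕ} {s : K × Baire} {k : K} (hs : s.2 ∈ closure (M k)) :
    (nextGuess M n s k).2 ∈ cyl s.2 n := by
  unfold nextGuess
  have h₂ := mem_closure_baire.1 hs n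
  split_ifs with h₁
  exacts [PiNat.self_mem_cylinder _ _, h₂.some_mem.1]

end Guess

section Selection

variable {K : Type*} [PartialOrder K] (h : Baire → K) (M : K → Set Baire)

/-- The map `h` takes its least value on the set `C`. -/
def HasLeast (C : Set Baire) : Prop := ∃ b ∈ C, ∀ c ∈ C, h b ≤ h c

open Classical in
/-- The guess after reading the first `n` coordinates. -/
noncomputable def guess : ℕ → Baire → K × Baire
  | 0, _ => (h 0, if H : (M (h 0)).Nonempty then H.some else 0)
  | n + 1, a =>
    if H : HasLeast h (cyl a n) then nextGuess M n (guess n a) (h H.choose) else guess n a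

variable {h M}

theorem HasLeast.eq_choose {C : Set Baire} {a : Baire} (H : HasLeast h C) (haC : a ∈ C)
    (ha : ∀ c ∈ C, h a ≤ h c) : h H.choose = h a :=
  (H.choose_spec.2 a haC).antisymm (ha _ H.choose_spec.1)

/-- Stage `n + 1` consults only the cylinder of length `n` and earlier stages. -/
theorem guess_congr {n : ℕ} {a b : Baire} (hb : b ∈ cyl a n) :
    guess h M (n + 1) b = guess h M (n + 1) a := by
  have key : ∀ n, cyl b n = cyl a n → guess h M n b = guess h M n a →
      guess h M (n + 1) b = guess h M (n + 1) a := by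
    intro n h₁ h₂
    simp only [guess, h₂]
    -- The chosen least point depends on a proof about the cylinder, so the two cylinders are
    -- identified as sets first.
    generalize cyl b n = C at h₁
    subst h₁
    rfl
  induction n with
  | zero => exact key 0 (cyl_eq hb) rfl
  | succ n ih => exact key _ (cyl_eq hb) (ih (PiNat.cylinder_anti a n.le_succ hb))

variable (hne : ∀ a, (M (h a)).Nonempty)
  (hM : ∀ a b, h a ≤ h b → M (h a) ⊆ closure (M (h b)))

include hne in
theorem guess_mem (n : ℕ) (a : Baire) :
    (guess h M n a).2 ∈ M (guess h M n a).1 ∧ (guess h M n a).1 ∈ Set.range h := by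
  induction n with
  | zero => simp only [guess, dif_pos (hne 0)]; exact ⟨(hne 0).some_mem, 0, rfl⟩
  | succ n ih =>
    rw [guess]
    split_ifs with H
    · rw [nextGuess_fst (hne _)]
      exact ⟨nextGuess_mem (hne _) ih.1, _, rfl⟩
    · exact ih

-- Once some cylinder has a least value, the guess stays a lower bound: an update takes the least
-- value of the current cylinder, and without an update the cylinder only shrinks.
include hne in
theorem guess_le {j : ℕ} {a : Baire} (hj : HasLeast h (cyl a j)) (d : ℕ) :
    ∀ c ∈ cyl a (j + d), (guess h M (j + d + 1) a).1 ≤ h c := by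
  have key : ∀ n, ∀ H : HasLeast h (cyl a n), ∀ c ∈ cyl a n, (guess h M (n + 1) a).1 ≤ h c := by
    intro n H c hc
    rw [guess, dif_pos H, nextGuess_fst (hne _)]
    exact H.choose_spec.2 c hc
  induction d with
  | zero => exact key j hj
  | succ d ih =>
    by_cases H : HasLeast h (cyl a (j + (d + 1)))
    · exact key _ H
    · intro c hc
      rw [guess, dif_neg H]
      exact ih c (PiNat.cylinder_anti a (by omega) hc)

-- Early jumps may be arbitrary. After a cylinder with a least value, guesses only increase, so the
-- current point lies in the closure of the next set and stage `m` can preserve its first `m`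
-- coordinates.
include hne hM in
theorem guess_mem_cyl {j n m : ℕ} {a : Baire} (hj : HasLeast h (cyl a j)) (hn : j < n)
    (hm : n ≤ m) :
    (guess h M m a).2 ∈ cyl (guess h M n a).2 n := by
  induction m, hm using Nat.le_induction with
  | base => exact PiNat.self_mem_cylinder _ _
  | succ m hm ih =>
    rw [guess]
    split_ifs with H
    · rw [← cyl_eq ih]
      refine PiNat.cylinder_anti _ hm (nextGuess_mem_cyl ?_)
      obtain ⟨h₁, b, hb⟩ := guess_mem hne m a
      rw [← hb] at h₁
      refine hM _ _ ?_ h₁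
      rw [hb]
      -- The guess at stage `m` was made on the cylinder of length `m - 1`, which contains the
      -- current one.
      obtain ⟨d, rfl⟩ : ∃ d, m = j + d + 1 := ⟨m - j - 1, by omega⟩
      exact guess_le hne hj d _ (PiNat.cylinder_anti a (Nat.le_succ _) H.choose_spec.1)
    · exact ih

include hne in
theorem guess_eq {a : Baire} {n : ℕ} (hn : ∀ c ∈ cyl a n, h a ≤ h c) {m : ℕ} (hm : n ≤ m) :
    (guess h M (m + 1) a).1 = h a ∧ guess h M (m + 1) a = guess h M (n + 1) a := by
  have key : ∀ m, n ≤ m → ∃ H : HasLeast h (cyl a m), h H.choose = h a := fun m hm =>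
    have ha : ∀ c ∈ cyl a m, h a ≤ h c := fun c hc => hn c (PiNat.cylinder_anti a hm hc)
    have H : HasLeast h (cyl a m) := ⟨a, PiNat.self_mem_cylinder a m, ha⟩
    ⟨H, H.eq_choose (PiNat.self_mem_cylinder a m) ha⟩
  induction m, hm using Nat.le_induction with
  | base =>
    obtain ⟨H, H'⟩ := key n le_rfl
    exact ⟨by rw [guess, dif_pos H, nextGuess_fst (hne _), H'], rfl⟩
  | succ m hm ih =>
    obtain ⟨H, H'⟩ := key (m + 1) (by omega)
    have : guess h M (m + 1 + 1) a = guess h M (m + 1) a := by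
      rw [guess, dif_pos H, nextGuess, if_pos (H'.trans ih.1.symm)]
    rw [this]
    exact ih

include hne hM in
/-- A map that increases locally, followed by a lower semicontinuous choice of sets, has a
continuous selection. -/
theorem exists_continuous_selection (hh : ∀ a, ∀ᶠ b in 𝓝 a, h a ≤ h b) :
    ∃ f : Baire → Baire, Continuous f ∧ ∀ a, f a ∈ M (h a) := by
  have hh' : ∀ a, ∃ n, ∀ c ∈ cyl a n, h a ≤ h c := fun a => mem_nhds_baire.1 (hh a)
  choose N hN using hh'
  have hH : ∀ a, HasLeast h (cyl a (N a)) := fun a => ⟨a, PiNat.self_mem_cylinder a _, hN a⟩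
  -- From stage `N a + 1` on, the guess along `a` is correct and constant, so this is the limit of
  -- the process.
  refine ⟨fun a => (guess h M (N a + 1) a).2, ?_, fun a => ?_⟩
  · refine continuous_pi fun i => continuous_iff_continuousAt.2 fun a => ?_
    refine tendsto_pure.2 ?_ |>.mono_right (pure_le_nhds _)
    filter_upwards [cyl_mem_nhds a (max (N a) i)] with b hb
    set n := max (N a) i with hn
    have hbN : b ∈ cyl a (N a) := PiNat.cylinder_anti a (le_max_left _ _) hb
    have hj : HasLeast h (cyl b (N a)) := by rw [cyl_eq hbN]; exact hH a
    -- At stage `n + 1` the points `a` and `b` share one guess, already final for `a`; later changes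
    -- along `b` preserve `n + 1` coordinates, among them coordinate `i`.
    have h₁ := guess_mem_cyl hne hM hj (n := n + 1) (m := max n (N b) + 1) (by omega) (by omega)
    rw [(guess_eq (M := M) hne (hN b) (le_max_right _ _)).2, guess_congr hb,
      (guess_eq (M := M) hne (hN a) (le_max_left _ _)).2] at h₁
    exact h₁ i (by omega)
  · have := (guess_mem hne (N a + 1) a).1
    rwa [(guess_eq hne (hN a) le_rfl).1] at this

end Selection

end TotRep

namespace TotRep

open Filter Topology

/-! ### Invariants of quotients of preorders -/

/-- The non-empty downward closed sets of reduced trees. -/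
def starTrees (p : PosetCode) : Set (Set ℕ) := {S | S ∈ lowerTrees p ∧ S.Nonempty}

theorem mem_of_mem_children {p : PosetCode} (hp : p.Valid) {S : Set ℕ} (hS : S ∈ lowerTrees p)
    {s t : ℕ} (ht : t ∈ S) (hs : s ∈ children t) : s ∈ S :=
  hS.2 t ht s (mem_trees_of_mem_children hp (hS.1 ht) hs).1 (.child hs (TLe.refl s))

theorem nonempty_of_mem_fullLowerTrees {p : PosetCode} {S : Set ℕ} (hS : S ∈ fullLowerTrees p)
    (hp : p.1 ≠ 0) : S.Nonempty := ⟨_, hS.2 0 (Nat.pos_of_ne_zero hp)⟩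

/-- An invariant that preserves and reflects the preorder identifies equivalent elements, so it
embeds the quotient; applied to representations and to both segments of the forest order. -/
theorem nonempty_orderIso_of_invariant {Q V : Type*} [Preorder Q] [PartialOrder V]
    (B : Set (Antisymmetrization Q (· ≤ ·))) (F : Set V) (D : Q → V)
    (hD : ∀ q q', toAntisymmetrization (· ≤ ·) q ∈ B → toAntisymmetrization (· ≤ ·) q' ∈ B →
      (D q ≤ D q' ↔ q ≤ q'))
    (hF : ∀ q, toAntisymmetrization (· ≤ ·) q ∈ B → D q ∈ F)
    (hs : ∀ S ∈ F, ∃ q, toAntisymmetrization (· ≤ ·) q ∈ B ∧ D q = S) : Nonempty (B ≃o F) := by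
  have hB : ∀ x : B, toAntisymmetrization (· ≤ ·) (ofAntisymmetrization (· ≤ ·) x.1) ∈ B :=
    fun x => by rw [toAntisymmetrization_ofAntisymmetrization]; exact x.2
  let f : B → F := fun x => ⟨D (ofAntisymmetrization (· ≤ ·) x.1), hF _ (hB x)⟩
  have hf : ∀ x y, f x ≤ f y ↔ x ≤ y := fun x y => by
    rw [Subtype.mk_le_mk, hD _ _ (hB x) (hB y), ofAntisymmetrization_le_ofAntisymmetrization_iff]
    rfl
  refine ⟨RelIso.ofSurjective (OrderEmbedding.ofMapLEIff f hf) ?_⟩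
  rintro ⟨S, hS⟩
  obtain ⟨q, hq, rfl⟩ := hs S hS
  refine ⟨⟨_, hq⟩, Subtype.ext ?_⟩
  have h := toAntisymmetrization_ofAntisymmetrization (r := (· ≤ ·))
    (toAntisymmetrization (· ≤ ·) q)
  exact le_antisymm
    ((hD _ _ (hB ⟨_, hq⟩) hq).2 (toAntisymmetrization_le_toAntisymmetrization_iff.1 h.le))
    ((hD _ _ hq (hB ⟨_, hq⟩)).2 (toAntisymmetrization_le_toAntisymmetrization_iff.1 h.ge))

/-! ### Total representations as labelings of the Baire space -/

theorem isOpenTR_iff {A : Set (Set Baire)} [Finite A] (hA : ∀ U ∈ A, IsOpen U)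
    {ν : Baire → Set Baire} (hν : ∀ a, ν a ∈ A) :
    IsOpenTR ν ↔ ∀ a, ∀ᶠ b in 𝓝 a, ν a ⊆ ν b := by
  constructor
  · intro h a
    have : ∀ᶠ b in 𝓝 a, ∀ V ∈ A, ν b = V → ν a ⊆ V := by
      rw [Filter.eventually_all_finite (Set.toFinite A)]
      intro V _
      by_cases hV : ν a ⊆ V
      · simp [hV]
      -- A point of `ν a` outside `V` excludes the value `V` on the open slice at that point.
      · obtain ⟨x, hx, hxV⟩ := Set.not_subset.1 hV
        have : IsOpen {b | x ∈ ν b} := h.preimage (by fun_prop : Continuous fun b => (b, x))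
        filter_upwards [this.mem_nhds hx] with b hb hbV
        exact absurd (hbV ▸ hb) hxV
    filter_upwards [this] with b hb
    exact hb _ (hν b) rfl
  · intro h
    refine isOpen_iff_mem_nhds.2 fun ⟨a, x⟩ hx => ?_
    filter_upwards [prod_mem_nhds (h a) ((hA _ (hν a)).mem_nhds hx)] with y hy
    exact hy.1 hy.2

section Label

variable {A : Set (Set Baire)} {p : PosetCode} (e : Fin p.1 ≃ A)

/-- The labeling of the Baire space by the numbers of the values of `ν`. -/
def repLabel (ν : Baire → Set Baire) (hν : ∀ a, ν a ∈ A) (a : Baire) : ℕ := e.symm ⟨ν a, hν a⟩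

variable {e} (he : ∀ i j : Fin p.1, e i ≤ e j ↔ ((i : ℕ), (j : ℕ)) ∈ p.2)

theorem repLabel_lt {ν : Baire → Set Baire} (hν : ∀ a, ν a ∈ A) (a : Baire) :
    repLabel e ν hν a < p.1 := Fin.is_lt _

include he in
theorem isLabeling_repLabel [Finite A] (hA : ∀ U ∈ A, IsOpen U) {ν : Baire → Set Baire}
    (hν : ∀ a, ν a ∈ A) (h : IsOpenTR ν) : IsLabeling p (repLabel e ν hν) := by
  refine ⟨repLabel_lt hν, fun a => ?_⟩
  filter_upwards [(isOpenTR_iff hA hν).1 h a] with b hb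
  refine (he _ _).1 ?_
  simpa using hb

theorem repLabel_comp {μ : Baire → Set Baire} (hμ : ∀ a, μ a ∈ A) (f : Baire → Baire) :
    repLabel e (μ ∘ f) (fun a => hμ (f a)) = repLabel e μ hμ ∘ f := rfl

theorem repLabel_eq_iff {ν μ : Baire → Set Baire} {hν : ∀ a, ν a ∈ A} {hμ : ∀ a, μ a ∈ A}
    {a b : Baire} : repLabel e ν hν a = repLabel e μ hμ b ↔ ν a = μ b := by
  simp [repLabel, Fin.val_inj]

include he in
theorem exists_rep [Finite A] (hA : ∀ U ∈ A, IsOpen U) {l : Baire → ℕ} (hl : IsLabeling p l) :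
    ∃ (ν : Baire → Set Baire) (hν : ∀ a, ν a ∈ A), IsOpenTR ν ∧ repLabel e ν hν = l := by
  refine ⟨fun a => e ⟨l a, hl.lt a⟩, fun a => (e _).2, (isOpenTR_iff hA fun a => (e _).2).2 ?_, ?_⟩
  · intro a
    filter_upwards [hl.eventually_le a] with b hb
    exact (he ⟨l a, hl.lt a⟩ ⟨l b, hl.lt b⟩).2 hb
  · ext a
    simp [repLabel]

include he in
theorem reducible_iff [Finite A] (hp : p.Valid) (hA : ∀ U ∈ A, IsOpen U)
    {ν μ : Baire → Set Baire} (hν : ∀ a, ν a ∈ A) (hμ : ∀ a, μ a ∈ A) (hνo : IsOpenTR ν) :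
    realized p (repLabel e ν hν) ⊆ realized p (repLabel e μ hμ) ↔ Reducible ν μ := by
  have hl := isLabeling_repLabel he hA hν hνo
  constructor
  · intro h
    -- Germs shrink locally, so the reversed inclusion order makes them increase locally.
    obtain ⟨f, hf, hf'⟩ := exists_continuous_selection (K := (Set ℕ)ᵒᵈ)
      (h := fun a => OrderDual.toDual (germ p (repLabel e ν hν) a))
      (M := fun S => germRealize p (repLabel e ν hν) (repLabel e μ hμ) (OrderDual.ofDual S))
      (fun a => hl.germRealize_nonempty hp h a) (fun a b hab => hl.germRealize_subset hp hab)
      (fun a => eventually_germ_subset p _ a)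
    refine ⟨f, hf, funext fun a => ?_⟩
    exact (repLabel_eq_iff (hμ := hμ)).1 (hl.eq_of_mem_germRealize hp (hf' a))
  · rintro ⟨f, hf, rfl⟩
    rw [repLabel_comp hμ]
    exact realized_comp_subset hf

theorem range_repLabel {ν : Baire → Set Baire} (hν : ∀ a, ν a ∈ A) :
    Set.range ν = A ↔ ∀ i < p.1, i ∈ Set.range (repLabel e ν hν) := by
  constructor
  · intro h i hi
    obtain ⟨a, ha⟩ := h.ge (e ⟨i, hi⟩).2
    exact ⟨a, by simp [repLabel, ha]⟩
  · intro h
    refine (Set.range_subset_iff.2 hν).antisymm fun U hU => ?_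
    obtain ⟨a, ha⟩ := h (e.symm ⟨U, hU⟩) (Fin.is_lt _)
    refine ⟨a, ?_⟩
    have := e.symm.injective (Fin.val_injective ha)
    simpa using this

end Label

/-! ### A labeling of the Baire space that realizes a given set of trees -/

section Descend

open Classical in
/-- Follow a branch of subtrees: start with the tree `a 0` of `S` (or with `t₀`), and move to the
subtree `a (n + 1)` whenever this is a child of the current one. -/
noncomputable def descend (S : Set ℕ) (t₀ : ℕ) (a : Baire) : ℕ → ℕ
  | 0 => if a 0 ∈ S then a 0 else t₀
  | n + 1 => if a (n + 1) ∈ children (descend S t₀ a n) then a (n + 1) else descend S t₀ a n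

variable {S : Set ℕ} {t₀ : ℕ}

theorem descend_reflTransGen (a : Baire) {n m : ℕ} (h : n ≤ m) :
    Relation.ReflTransGen (fun x y => y ∈ children x) (descend S t₀ a n) (descend S t₀ a m) := by
  induction m, h using Nat.le_induction with
  | base => exact .refl
  | succ m _ ih =>
    rw [descend]
    split_ifs with h
    exacts [ih.tail h, ih]

theorem le_of_reflTransGen_children {x y : ℕ}
    (h : Relation.ReflTransGen (fun x y => y ∈ children x) x y) : y ≤ x := by
  induction h with
  | refl => exact le_rfl
  | tail _ h ih => exact (lt_of_mem_children h).le.trans ih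

/-- Passing to a child lowers the code, so the branch is constant once its code is minimal. -/
theorem exists_descend_eq (S : Set ℕ) (t₀ : ℕ) (a : Baire) :
    ∃ N, ∀ n, N ≤ n → descend S t₀ a n = descend S t₀ a N := by
  obtain ⟨N, hN⟩ := wellFounded_lt.has_min (Set.range (descend S t₀ a)) (Set.range_nonempty _)
  obtain ⟨⟨N, rfl⟩, hN'⟩ := hN
  exact ⟨N, fun n hn => le_antisymm (le_of_reflTransGen_children (descend_reflTransGen a hn))
    (not_lt.1 (hN' _ ⟨n, rfl⟩))⟩

/-- The last subtree of the branch. -/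
noncomputable def descendLimit (S : Set ℕ) (t₀ : ℕ) (a : Baire) : ℕ :=
  descend S t₀ a (exists_descend_eq S t₀ a).choose

theorem exists_descend_eq_limit (S : Set ℕ) (t₀ : ℕ) (a : Baire) :
    ∃ N, ∀ n, N ≤ n → descend S t₀ a n = descendLimit S t₀ a :=
  ⟨_, (exists_descend_eq S t₀ a).choose_spec⟩

theorem descend_congr {a b : Baire} {n : ℕ} (h : ∀ i ≤ n, b i = a i) :
    descend S t₀ b n = descend S t₀ a n := by
  induction n with
  | zero => rw [descend, descend, h 0 le_rfl]
  | succ n ih => rw [descend, descend, ih fun i hi => h i (by omega), h (n + 1) le_rfl]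

theorem descendLimit_eq {a : Baire} {N s : ℕ} (h : ∀ n, N ≤ n → descend S t₀ a n = s) :
    descendLimit S t₀ a = s := by
  obtain ⟨N', hN'⟩ := exists_descend_eq_limit S t₀ a
  rw [← hN' (max N N') (le_max_right _ _), h _ (le_max_left _ _)]

theorem eventually_descendLimit (S : Set ℕ) (t₀ : ℕ) (a : Baire) : ∀ᶠ b in 𝓝 a,
    Relation.ReflTransGen (fun x y => y ∈ children x) (descendLimit S t₀ a)
      (descendLimit S t₀ b) := by
  obtain ⟨N, hN⟩ := exists_descend_eq_limit S t₀ a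
  -- Stage `N` reads the coordinates `0, …, N`.
  filter_upwards [cyl_mem_nhds a (N + 1)] with b hb
  obtain ⟨N', hN'⟩ := exists_descend_eq_limit S t₀ b
  rw [← hN N le_rfl, ← hN' (max N N') (le_max_right _ _),
    ← descend_congr fun i hi => hb i (Nat.lt_succ_of_le hi)]
  exact descend_reflTransGen b (le_max_left _ _)

theorem mem_closure_descendLimit {a : Baire} {s : ℕ} (hs : s ∈ children (descendLimit S t₀ a)) :
    a ∈ closure (descendLimit S t₀ ⁻¹' {s}) := by
  refine mem_closure_baire.2 fun n => ?_
  obtain ⟨N, hN⟩ := exists_descend_eq_limit S t₀ a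
  set m := max n N
  -- Follow `a` until its branch has settled, then ask for `s` forever: the first request moves to
  -- `s`, and later ones change nothing.
  let b : Baire := fun i => if i ≤ m then a i else s
  have hb : descend S t₀ b m = descendLimit S t₀ a :=
    (descend_congr fun i hi => if_pos hi).trans (hN m (le_max_right _ _))
  have hb' : ∀ j, m + 1 ≤ j → descend S t₀ b j = s := by
    intro j hj
    induction j, hj using Nat.le_induction with
    | base =>
      have : b (m + 1) = s := if_neg (by omega)
      rw [descend, hb, this, if_pos hs]
    | succ j hj ih =>
      have : b (j + 1) = s := if_neg (by omega)
      rw [descend, ih, this, ite_self]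
  refine ⟨b, fun i hi => if_pos ?_, descendLimit_eq hb'⟩
  exact hi.le.trans (le_max_left _ _)

theorem range_descendLimit (ht₀ : t₀ ∈ S) (hS : ∀ t ∈ S, ∀ s ∈ children t, s ∈ S) :
    Set.range (descendLimit S t₀) = S := by
  ext t
  constructor
  · rintro ⟨a, rfl⟩
    have : ∀ n, descend S t₀ a n ∈ S := fun n => by
      induction n with
      | zero => rw [descend]; split_ifs with h; exacts [h, ht₀]
      | succ n ih => rw [descend]; split_ifs with h; exacts [hS _ ih _ h, ih]
    exact this _
  · intro ht
    refine ⟨fun _ => t, descendLimit_eq (N := 0) fun n _ => ?_⟩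
    induction n with
    | zero => rw [descend, if_pos ht]
    | succ n ih => rw [descend, ih (Nat.zero_le _), ite_self]

theorem exists_labeling_realized_eq {p : PosetCode} (hp : p.Valid) (hS : S ∈ starTrees p) :
    ∃ l : Baire → ℕ, IsLabeling p l ∧ realized p l = S := by
  obtain ⟨hS, t₀, ht₀⟩ := hS
  have hr := range_descendLimit ht₀ fun t ht s hs => mem_of_mem_children hp hS ht hs
  exact ⟨root ∘ descendLimit S t₀,
    isLabeling_root_comp hp (fun a => hS.1 (hr.subset ⟨a, rfl⟩)) (eventually_descendLimit S t₀),
    realized_root_comp hS hr (eventually_descendLimit S t₀) fun _ _ => mem_closure_descendLimit⟩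

end Descend

/-! ### The posets of total representations as posets of sets of trees -/

section Iso

variable {A : Set (Set Baire)} {p : PosetCode}

theorem nonempty_lStar_orderIso [Finite A] (hA : ∀ U ∈ A, IsOpen U) (h : Presents p A) :
    Nonempty (LStar A ≃o starTrees p) := by
  have hp := h.valid
  obtain ⟨e, he⟩ := h
  have hmem : ∀ ν : SubRep A, ∀ a, ν.rep a ∈ A := fun ν a => ν.range_subset ⟨a, rfl⟩
  refine (nonempty_orderIso_of_invariant (Q := SubRep A) Set.univ (starTrees p)
    (fun ν => realized p (repLabel e ν.rep (hmem ν))) (fun ν μ _ _ => ?_) (fun ν _ => ?_)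
    fun S hS => ?_).map OrderIso.Set.univ.symm.trans
  · exact reducible_iff he hp hA (hmem ν) (hmem μ) ν.isOpenTR
  · exact ⟨IsLabeling.realized_mem_lowerTrees,
      (isLabeling_repLabel he hA (hmem ν) ν.isOpenTR).realized_nonempty hp⟩
  · obtain ⟨l, hl, rfl⟩ := exists_labeling_realized_eq hp hS
    obtain ⟨ν, hν, hνo, rfl⟩ := exists_rep he hA hl
    exact ⟨⟨ν, hνo, Set.range_subset_iff.2 hν⟩, trivial, rfl⟩

theorem nonempty_lFull_orderIso [Finite A] [Nonempty A] (hA : ∀ U ∈ A, IsOpen U)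
    (h : Presents p A) : Nonempty (LFull A ≃o fullLowerTrees p) := by
  have hp := h.valid
  obtain ⟨e, he⟩ := h
  have hp0 : p.1 ≠ 0 := by
    obtain ⟨U⟩ := ‹Nonempty A›
    exact (e.symm U).pos.ne'
  have hmem : ∀ ν : FullRep A, ∀ a, ν.rep a ∈ A := fun ν a => ν.range_eq.subset ⟨a, rfl⟩
  refine (nonempty_orderIso_of_invariant (Q := FullRep A) Set.univ (fullLowerTrees p : Set (Set ℕ))
    (fun ν => realized p (repLabel e ν.rep (hmem ν))) (fun ν μ _ _ => ?_) (fun ν _ => ?_)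
    fun S hS => ?_).map OrderIso.Set.univ.symm.trans
  · exact reducible_iff he hp hA (hmem ν) (hmem μ) ν.isOpenTR
  · exact ⟨IsLabeling.realized_mem_lowerTrees, fun i hi => (node_nil_mem_realized hp hi).2
      ((range_repLabel (hmem ν)).1 ν.range_eq i hi)⟩
  · obtain ⟨l, hl, rfl⟩ := exists_labeling_realized_eq hp
      ⟨hS.1, nonempty_of_mem_fullLowerTrees hS hp0⟩
    obtain ⟨ν, hν, hνo, rfl⟩ := exists_rep he hA hl
    exact ⟨⟨ν, hνo, (range_repLabel hν).2 fun i hi =>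
      (node_nil_mem_realized hp hi).1 (hS.2 i hi)⟩, trivial, rfl⟩

end Iso

/-! ### The lattices of sets of trees -/

theorem isFiniteDistribLattice_of_orderIso {X : Type} [PartialOrder X] {F : Sublattice (Set ℕ)}
    (e : X ≃o F) {L : List ℕ} (hF : ∀ S ∈ F, S ⊆ {t | t ∈ L}) (hne : (F : Set (Set ℕ)).Nonempty) :
    IsFiniteDistribLattice X := by
  have hfin : Finite F := by
    refine Set.Finite.to_subtype ((Set.Finite.powerset (L.finite_toSet)).subset ?_)
    exact fun S hS => hF S hS
  obtain ⟨S, hS⟩ := hne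
  exact ⟨Finite.of_equiv _ e.toEquiv.symm, ⟨e.symm ⟨S, hS⟩⟩, F, inferInstance, ⟨e⟩⟩

theorem isFiniteDistribLattice_lFull {X : Type} [PartialOrder X] {p : PosetCode} (hp : p.Valid)
    (e : X ≃o fullLowerTrees p) : IsFiniteDistribLattice X :=
  isFiniteDistribLattice_of_orderIso e (fun _ hS => hS.1.1)
    ⟨{t | t ∈ trees p}, ⟨⟨subset_rfl, fun _ _ _ h _ => h⟩, fun _ hi => node_nil_mem_trees hp hi⟩⟩

theorem isFiniteDistribLattice_withBot_lStar {X : Type} [PartialOrder X] {p : PosetCode}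
    (e : X ≃o starTrees p) : IsFiniteDistribLattice (WithBot X) := by
  -- The empty set is the one lower set that no non-empty space realizes; the adjoined bottom takes
  -- its place.
  let f : WithBot X → lowerTrees p := fun x =>
    x.recBotCoe ⟨∅, Set.empty_subset _, fun _ h => h.elim⟩ fun x => ⟨e x, (e x).2.1⟩
  have hf : ∀ x y, f x ≤ f y ↔ x ≤ y := by
    intro x y
    induction x with
    | bot => exact iff_of_true (Set.empty_subset (f y : Set ℕ)) bot_le
    | coe x =>
      induction y with
      | bot =>
        simp only [WithBot.not_coe_le_bot, iff_false]
        intro h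
        obtain ⟨t, ht⟩ := (e x).2.2
        exact h ht
      | coe y =>
        rw [WithBot.coe_le_coe, ← e.le_iff_le]
        rfl
  refine isFiniteDistribLattice_of_orderIso
    (RelIso.ofSurjective (OrderEmbedding.ofMapLEIff f hf) ?_) (L := trees p) (fun _ hS => hS.1)
    ⟨∅, Set.empty_subset _, fun _ h => h.elim⟩
  rintro ⟨S, hS⟩
  rcases S.eq_empty_or_nonempty with rfl | hne
  · exact ⟨⊥, rfl⟩
  · exact ⟨(e.symm ⟨S, hS, hne⟩ : X), Subtype.ext
      (congrArg (fun T : starTrees p => (T : Set ℕ)) (e.apply_symm_apply ⟨S, hS, hne⟩))⟩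

end TotRep

namespace TotRep

open Filter Topology

/-! ### Paths -/

namespace Path

variable {P : Type} [PartialOrder P]

/-- The path `w` followed by an immediate successor of its endpoint. -/
def snoc (w : Path P) (z : P) (h : w.last ⋖ z) : Path P where
  toList := w.toList ++ [z]
  ne_nil := by simp
  isMin_head := by rw [List.head_append_of_ne_nil w.ne_nil]; exact w.isMin_head
  isChain := by
    refine List.isChain_append.2 ⟨w.isChain, by simp, ?_⟩
    intro x hx y hy
    rw [List.getLast?_eq_getLast_of_ne_nil w.ne_nil, Option.mem_some_iff] at hx
    simp only [List.head?_cons, Option.mem_some_iff] at hy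
    subst hx hy
    exact h

theorem le_snoc (w : Path P) (z : P) (h : w.last ⋖ z) : w ≤ w.snoc z h :=
  List.prefix_append _ _

theorem last_snoc (w : Path P) (z : P) (h : w.last ⋖ z) : (w.snoc z h).last = z := by
  simp [last, snoc]

theorem last_mono {v w : Path P} (h : v ≤ w) : v.last ≤ w.last := by
  obtain ⟨l, hl⟩ := h
  have hw : w.toList.Pairwise (· < ·) :=
    List.isChain_iff_pairwise.1 (w.isChain.imp fun _ _ h => h.lt)
  rcases l.eq_nil_or_concat with rfl | ⟨l, z, rfl⟩
  · rw [List.append_nil] at hl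
    exact (congrArg last (toList_injective hl)).le
  · have hz : w.last = z := by simp [last, ← hl]
    rw [← hl] at hw
    rw [hz]
    exact ((List.pairwise_append.1 hw).2.2 _ (List.getLast_mem v.ne_nil) z (by simp)).le

theorem exists_le_last_eq [Finite P] (w : Path P) {y : P} (h : w.last ≤ y) :
    ∃ w', w ≤ w' ∧ w'.last = y := by
  classical
  cases nonempty_fintype P
  let _ : LocallyFiniteOrder P := Fintype.toLocallyFiniteOrder
  rw [le_iff_reflTransGen_covBy] at h
  induction h with
  | refl => exact ⟨w, le_rfl, rfl⟩
  | tail _ h ih =>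
    obtain ⟨w', h₁, rfl⟩ := ih
    exact ⟨w'.snoc _ h, h₁.trans (le_snoc _ _ _), last_snoc _ _ _⟩

theorem exists_last_eq [Finite P] (y : P) : ∃ w : Path P, w.last = y := by
  obtain ⟨m, hm, hm'⟩ := (Set.toFinite {m : P | m ≤ y}).exists_le_minimal (le_refl y)
  let v : Path P := ⟨[m], by simp, fun x hx => hm'.2 (hx.trans hm) hx, by simp⟩
  obtain ⟨w, -, hw⟩ := v.exists_le_last_eq (y := y) hm
  exact ⟨w, hw⟩

end Path

/-! ### Monotone selections on forests -/

/-- The order analogue of the continuous selection. Values are assigned along growing lower sets: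
the predecessors of a new maximal element form a chain, so one value above that of the largest
predecessor dominates all of them. -/
theorem exists_monotone_selection {G Y : Type*} [PartialOrder G] [Finite G] [Preorder Y]
    (hG : ∀ x y z : G, y ≤ x → z ≤ x → y ≤ z ∨ z ≤ y) (M : G → Set Y)
    (hne : ∀ x, (M x).Nonempty) (hM : ∀ x y, x ≤ y → ∀ v ∈ M x, ∃ w ∈ M y, v ≤ w) :
    ∃ g : G → Y, Monotone g ∧ ∀ x, g x ∈ M x := by
  classical
  cases nonempty_fintype G
  have key : ∀ n : ℕ, ∀ s : Finset G, s.card = n → IsLowerSet (s : Set G) →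
      ∃ g : G → Y, MonotoneOn g s ∧ ∀ x, g x ∈ M x := by
    intro n
    induction n with
    | zero =>
      intro s hs _
      rw [Finset.card_eq_zero] at hs
      subst hs
      exact ⟨fun x => (hne x).some, by simp [MonotoneOn], fun x => (hne x).some_mem⟩
    | succ n ih =>
      intro s hs hl
      have hs0 : s.Nonempty := Finset.card_pos.1 (by omega)
      obtain ⟨x, hx⟩ := s.exists_maximal hs0
      obtain ⟨g, hg, hgM⟩ := ih (s.erase x) (by rw [Finset.card_erase_of_mem hx.1]; omega) (by
        intro a b hba ha
        simp only [Finset.coe_erase, Set.mem_sdiff, Set.mem_singleton_iff] at ha ⊢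
        refine ⟨hl hba ha.1, ?_⟩
        rintro rfl
        exact ha.2 (le_antisymm (hx.2 ha.1 hba) hba))
      obtain ⟨w, hwM, hw⟩ : ∃ w ∈ M x, ∀ z < x, g z ≤ w := by
        rcases {z | z < x}.eq_empty_or_nonempty with h | h
        · refine ⟨_, (hne x).some_mem, fun z hz => ?_⟩
          exact absurd (show z ∈ {z | z < x} from hz) (h ▸ Set.notMem_empty z)
        · obtain ⟨y, hy⟩ := (Set.toFinite {z | z < x}).exists_maximal h
          obtain ⟨w, hwM, hw⟩ := hM y x (le_of_lt hy.1) _ (hgM y)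
          have hmem : ∀ z < x, z ∈ ((s.erase x : Finset G) : Set G) := fun z hz => by
            simp only [Finset.coe_erase, Set.mem_sdiff, Set.mem_singleton_iff]
            exact ⟨hl hz.le hx.1, hz.ne⟩
          refine ⟨w, hwM, fun z hz => ?_⟩
          have hzy : z ≤ y := (hG x z y hz.le (le_of_lt hy.1)).elim id fun h => hy.2 hz h
          exact (hg (hmem z hz) (hmem y hy.1) hzy).trans hw
      refine ⟨Function.update g x w, fun a ha b hb hab => ?_, fun y => ?_⟩
      · rcases eq_or_ne b x with rfl | hbx
        · rcases eq_or_ne a b with rfl | hax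
          · exact le_rfl
          · rw [Function.update_self, Function.update_of_ne hax]
            exact hw a (lt_of_le_of_ne hab hax)
        · rcases eq_or_ne a x with rfl | hax
          · exact absurd (le_antisymm (hx.2 hb hab) hab) hbx
          · rw [Function.update_of_ne hax, Function.update_of_ne hbx]
            exact hg (by simpa using ⟨ha, hax⟩) (by simpa using ⟨hb, hbx⟩) hab
      · rcases eq_or_ne y x with rfl | hyx
        · simpa using hwM
        · simpa [hyx] using hgM y
  obtain ⟨g, hg, hgM⟩ := key _ Finset.univ rfl (by simpa using isLowerSet_univ)
  exact ⟨g, fun a b hab => hg (by simp) (by simp) hab, hgM⟩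

/-! ### Forests as labeled spaces -/

section Forest

open Topology

/-- On a forest, being realized arbitrarily close to a point means being realized somewhere above
it. -/
theorem mem_closure_upperSet {X : Type*} [Preorder X] {s : Set (WithUpperSet X)}
    {x : WithUpperSet X} : x ∈ closure s ↔ ∃ y ∈ s, x ≤ y := by
  rw [IsUpperSet.closure_eq_lowerClosure]
  rfl

theorem eventually_upperSet {X : Type*} [Preorder X] {q : WithUpperSet X → Prop}
    {x : WithUpperSet X} : (∀ᶠ y in 𝓝 x, q y) ↔ ∀ y, x ≤ y → q y := by
  rw [IsUpperSet.nhds_eq_principal_Ici]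
  rfl

variable {k : ℕ}

/-- The labeling of a forest, on the forest with the topology of the upper sets. -/
def forestLabel (G : KForest k) (x : WithUpperSet G.carrier) : ℕ :=
  G.label (WithUpperSet.ofUpperSet x)

variable {P : Type} [PartialOrder P] [Finite P] [Nonempty P] {c : P ≃ Fin k}

/-- A path extends to one ending at any element above its endpoint, so a monotone choice of
endpoints on a forest lifts to a monotone choice of paths. -/
theorem le_unfolding_iff {G : KForest k} : G ≤ unfolding c ↔
    ∀ x y : G.carrier, x ≤ y → c.symm (G.label x) ≤ c.symm (G.label y) := by
  constructor
  · rintro ⟨f, hf, hfl⟩ x y hxy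
    have : ∀ x, c.symm (G.label x) = (f x : Path P).last := fun x => by
      rw [hfl]; exact c.symm_apply_apply _
    rw [this, this]
    exact Path.last_mono (hf hxy)
  · intro h
    obtain ⟨g, hg, hgM⟩ := exists_monotone_selection (Y := Path P) G.chain_below
      (fun x => {w | w.last = c.symm (G.label x)}) (fun x => Path.exists_last_eq _)
      fun x y hxy v hv => by
        obtain ⟨w, h₁, h₂⟩ := v.exists_le_last_eq (y := c.symm (G.label y)) (by
          rw [show v.last = _ from hv]; exact h x y hxy)
        exact ⟨w, h₂, h₁⟩
    refine ⟨g, hg, fun x => ?_⟩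
    change G.label x = c (g x).last
    rw [show (g x).last = _ from hgM x, Equiv.apply_symm_apply]

variable {r : List (ℕ × ℕ)}
  (hc : ∀ i j : Fin k, c.symm i ≤ c.symm j ↔ ((i : ℕ), (j : ℕ)) ∈ r)

include hc in
theorem isLabeling_forestLabel_iff {G : KForest k} :
    IsLabeling (k, r) (forestLabel G) ↔ G ≤ unfolding c := by
  rw [le_unfolding_iff]
  simp only [hc]
  exact ⟨fun h x y hxy => eventually_upperSet.1 (h.eventually_le (WithUpperSet.toUpperSet x)) y hxy,
    fun h => ⟨fun x => Fin.is_lt _, fun x => eventually_upperSet.2 fun y hxy => h x y hxy⟩⟩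

theorem forest_le_iff {p : PosetCode} (hp : p.Valid) {G H : KForest k}
    (hG : IsLabeling p (forestLabel G)) :
    realized p (forestLabel G) ⊆ realized p (forestLabel H) ↔ G ≤ H := by
  constructor
  · intro h
    obtain ⟨g, hg, hgM⟩ := exists_monotone_selection (G := G.carrier)
      (Y := WithUpperSet H.carrier) G.chain_below
      (fun x => germRealize p (forestLabel G) (forestLabel H)
        (germ p (forestLabel G) (WithUpperSet.toUpperSet x)))
      (fun x => hG.germRealize_nonempty hp h _) fun x y hxy v hv => by
        obtain ⟨w, h₁, h₂⟩ := mem_closure_upperSet.1 (hG.germRealize_subset hp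
          (eventually_upperSet.1 (eventually_germ_subset p (forestLabel G)
            (WithUpperSet.toUpperSet x)) (WithUpperSet.toUpperSet y) hxy) hv)
        exact ⟨w, h₁, h₂⟩
    refine ⟨g, hg, fun x => Fin.val_injective ?_⟩
    have : forestLabel G (WithUpperSet.toUpperSet x) = forestLabel H (g x) :=
      hG.eq_of_mem_germRealize hp (hgM x)
    exact this
  · rintro ⟨f, hf, hfl⟩
    let f' : WithUpperSet G.carrier → WithUpperSet H.carrier := f
    have hf' : Continuous f' := IsUpperSet.monotone_iff_continuous.1 hf
    have : forestLabel G = forestLabel H ∘ f' := funext fun x => congrArg Fin.val (hfl x)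
    rw [this]
    exact realized_comp_subset hf'

/-- The trees in `S`, ordered by the descendant relation. -/
def Descendants (S : Set ℕ) : Type := S

instance (S : Set ℕ) : PartialOrder (Descendants S) where
  le x y := Relation.ReflTransGen (fun x y => y ∈ children x) x.1 y.1
  le_refl _ := .refl
  le_trans _ _ _ h₁ h₂ := Relation.ReflTransGen.trans h₁ h₂
  le_antisymm _ _ h₁ h₂ := Subtype.ext
    (le_antisymm (le_of_reflTransGen_children h₂) (le_of_reflTransGen_children h₁))

/-- Unfolding the descendant order on `S` gives a forest whose points end at trees of `S`; labeled
by the roots of these trees, it realizes exactly the trees below some member of `S`. -/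
theorem exists_forest_realized_eq (hp : PosetCode.Valid (k, r)) {S : Set ℕ}
    (hS : S ∈ starTrees (k, r)) :
    ∃ G : KForest k, IsLabeling (k, r) (forestLabel G) ∧ realized (k, r) (forestLabel G) = S := by
  obtain ⟨hS, t₀, ht₀⟩ := hS
  have : Finite (Descendants S) := ((trees (k, r)).finite_toSet.subset hS.1).to_subtype
  have : Nonempty (Descendants S) := ⟨⟨t₀, ht₀⟩⟩
  let G : KForest k := unfolding fun x : Descendants S =>
    (⟨root x.1, ((mem_trees hp).1 (hS.1 x.2)).1⟩ : Fin k)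
  let u : WithUpperSet G.carrier → ℕ := fun w => (Path.last (P := Descendants S) w).1
  have hu : Set.range u = S := by
    ext t
    constructor
    · rintro ⟨w, rfl⟩
      exact Subtype.prop _
    · intro ht
      obtain ⟨w, hw⟩ := Path.exists_last_eq (P := Descendants S) ⟨t, ht⟩
      exact ⟨w, congrArg Subtype.val hw⟩
  have h₁ : ∀ a, ∀ᶠ b in 𝓝 a, Relation.ReflTransGen (fun x y => y ∈ children x) (u a) (u b) :=
    fun a => eventually_upperSet.2 fun b hab => Path.last_mono (P := Descendants S) hab
  have h₂ : ∀ a, ∀ s ∈ children (u a), a ∈ closure (u ⁻¹' {s}) := by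
    intro a s hs
    have hsS : s ∈ S := mem_of_mem_children hp hS (hu.subset ⟨a, rfl⟩) hs
    -- A child need not be an immediate successor in the descendant order, but some extension of the
    -- path reaches it.
    obtain ⟨w, hw, hws⟩ := Path.exists_le_last_eq (P := Descendants S) a (y := ⟨s, hsS⟩)
      (Relation.ReflTransGen.single hs)
    exact mem_closure_upperSet.2 ⟨w, congrArg Subtype.val hws, hw⟩
  exact ⟨G, isLabeling_root_comp hp (fun a => hS.1 (hu.subset ⟨a, rfl⟩)) h₁,
    realized_root_comp hS hu h₁ h₂⟩

theorem eClass_le_iff [NeZero k] {G : KForest k} :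
    eClass k ≤ hClass G ↔ ∀ i < k, i ∈ Set.range (forestLabel G) := by
  rw [isLUB_le_iff (isLUB_eClass k)]
  constructor
  · intro h i hi
    obtain ⟨f, -, hf⟩ := toAntisymmetrization_le_toAntisymmetrization_iff.1 (h ⟨⟨i, hi⟩, rfl⟩)
    exact ⟨f (), (congrArg Fin.val (hf ())).symm⟩
  · rintro h _ ⟨i, rfl⟩
    obtain ⟨x, hx⟩ := h i i.2
    exact toAntisymmetrization_le_toAntisymmetrization_iff.2
      ⟨fun _ => x, fun _ _ _ => le_rfl, fun _ => Fin.val_injective hx.symm⟩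

include hc in
theorem nonempty_Iic_orderIso (hp : PosetCode.Valid (k, r)) :
    Nonempty (Set.Iic (hClass (unfolding c)) ≃o starTrees (k, r)) := by
  have hB : ∀ G : KForest k, toAntisymmetrization (· ≤ ·) G ∈ Set.Iic (hClass (unfolding c)) ↔
      IsLabeling (k, r) (forestLabel G) := fun G => by
    rw [isLabeling_forestLabel_iff hc]
    exact toAntisymmetrization_le_toAntisymmetrization_iff
  refine nonempty_orderIso_of_invariant _ _ (fun G => realized (k, r) (forestLabel G))
    (fun G H hG _ => forest_le_iff hp ((hB G).1 hG)) (fun G hG => ?_) fun S hS => ?_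
  · have : Nonempty (WithUpperSet G.carrier) := G.nonempty
    exact ⟨IsLabeling.realized_mem_lowerTrees, ((hB G).1 hG).realized_nonempty hp⟩
  · obtain ⟨G, hG, rfl⟩ := exists_forest_realized_eq hp hS
    exact ⟨G, (hB G).2 hG, rfl⟩

include hc in
theorem nonempty_Icc_orderIso [NeZero k] (hp : PosetCode.Valid (k, r)) :
    Nonempty (Set.Icc (eClass k) (hClass (unfolding c)) ≃o fullLowerTrees (k, r)) := by
  have hB : ∀ G : KForest k,
      toAntisymmetrization (· ≤ ·) G ∈ Set.Icc (eClass k) (hClass (unfolding c)) ↔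
      IsLabeling (k, r) (forestLabel G) ∧ ∀ i < k, node i [] ∈ realized (k, r) (forestLabel G) :=
    fun G => by
    have h : (∀ i < k, node i [] ∈ realized (k, r) (forestLabel G)) ↔ eClass k ≤ hClass G := by
      rw [eClass_le_iff]
      exact forall₂_congr fun i hi => node_nil_mem_realized hp hi
    rw [isLabeling_forestLabel_iff hc, h, and_comm]
    exact and_congr toAntisymmetrization_le_toAntisymmetrization_iff Iff.rfl
  refine nonempty_orderIso_of_invariant _ (fullLowerTrees (k, r) : Set (Set ℕ))
    (fun G => realized (k, r) (forestLabel G))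
    (fun G H hG _ => forest_le_iff hp ((hB G).1 hG).1) (fun G hG => ?_) fun S hS => ?_
  · exact ⟨IsLabeling.realized_mem_lowerTrees, ((hB G).1 hG).2⟩
  · obtain ⟨G, hG, rfl⟩ := exists_forest_realized_eq hp
      ⟨hS.1, nonempty_of_mem_fullLowerTrees hS (NeZero.ne k)⟩
    exact ⟨G, (hB G).2 ⟨hG, hS.2⟩, rfl⟩

end Forest

end TotRep

namespace TotRep

/-! ### Primitive recursive predicates with quantifiers over lists -/

section PrimrecLemmas

open Primrec

variable {α β σ : Type*} [Primcodable α] [Primcodable β] [Primcodable σ]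

theorem primrecPred_forall_mem {f : α → List β} {R : α → β → Prop} (hf : Primrec f)
    (hR : PrimrecRel R) : PrimrecPred fun a => ∀ b ∈ f a, R a b :=
  (PrimrecRel.forall_mem_list (R := fun b a => R a b) (hR.comp snd fst)).comp hf .id

theorem primrecPred_exists_mem {f : α → List β} {R : α → β → Prop} (hf : Primrec f)
    (hR : PrimrecRel R) : PrimrecPred fun a => ∃ b ∈ f a, R a b :=
  (PrimrecRel.exists_mem_list (R := fun b a => R a b) (hR.comp snd fst)).comp hf .id

theorem primrec_filter {f : α → List β} {R : α → β → Prop} [∀ a b, Decidable (R a b)]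
    (hf : Primrec f) (hR : PrimrecRel R) : Primrec fun a => (f a).filter fun b => R a b :=
  have : DecidableRel fun (b : β) (a : α) => R a b := fun b a => inferInstanceAs (Decidable (R a b))
  ((PrimrecRel.listFilter (R := fun b a => R a b) (hR.comp snd fst)).comp hf .id).of_eq
    fun _ => List.filter_congr fun _ _ => decide_eq_decide.2 Iff.rfl

theorem primrecPred_forall_lt {f : α → ℕ} {R : α → ℕ → Prop} (hf : Primrec f)
    (hR : PrimrecRel R) : PrimrecPred fun a => ∀ i < f a, R a i :=
  (primrecPred_forall_mem (list_range.comp hf) hR).of_eq (by simp)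

theorem primrecPred_mem {f : α → β} {g : α → List β} (hf : Primrec f) (hg : Primrec g) :
    PrimrecPred fun a => f a ∈ g a :=
  (primrecPred_exists_mem (R := fun a b => b = f a) hg
    (Primrec.eq.comp snd (hf.comp fst))).of_eq (by simp)

theorem primrecPred_imp {p q : α → Prop} (hp : PrimrecPred p) (hq : PrimrecPred q) :
    PrimrecPred fun a => p a → q a :=
  (hp.not.or hq).of_eq fun _ => imp_iff_not_or.symm

theorem primrecPred_iff {p q : α → Prop} (hp : PrimrecPred p) (hq : PrimrecPred q) :
    PrimrecPred fun a => p a ↔ q a :=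
  ((primrecPred_imp hp hq).and (primrecPred_imp hq hp)).of_eq
    fun _ => iff_iff_implies_and_implies.symm

theorem primrec_sublists' : Primrec (List.sublists' : List β → List (List β)) := by
  have : Primrec fun l : List β =>
      l.foldr (fun b (s : List (List β)) => s ++ s.map (List.cons b)) [[]] :=
    list_foldr (h := fun _ q => q.2 ++ q.2.map (List.cons q.1)) .id (const [[]])
      (list_append.comp (snd.comp snd) (list_map (snd.comp snd)
        (list_cons.comp (fst.comp (snd.comp fst)) snd).to₂)).to₂
  refine this.of_eq fun l => ?_
  induction l with
  | nil => rfl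
  | cons b l ih => rw [List.foldr_cons, ih, List.sublists'_cons]

end PrimrecLemmas

/-! ### Computing the trees -/

section Trees

open Primrec

theorem primrec_root : Primrec root := fst.comp unpair

theorem primrec_children : Primrec children := (Primrec.ofNat (List ℕ)).comp (snd.comp unpair)

theorem primrec_node : Primrec₂ node := Primrec₂.natPair.comp fst (Primrec.encode.comp snd)

theorem primrecRel_tle : PrimrecRel TLe := by
  classical
  -- Course-of-values recursion on codes of pairs: `l` lists the answers for all smaller codes, and
  -- its length is the code of the current pair.
  let R : List Bool → Prop := fun l =>
    (root l.length.unpair.1 = root l.length.unpair.2 ∧ ∀ s ∈ children l.length.unpair.1,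
      l.getD (Nat.pair s l.length.unpair.2) false = true) ∨
    ∃ s ∈ children l.length.unpair.2, l.getD (Nat.pair l.length.unpair.1 s) false = true
  have h₁ : Primrec fun l : List Bool => l.length.unpair.1 := fst.comp (unpair.comp list_length)
  have h₂ : Primrec fun l : List Bool => l.length.unpair.2 := snd.comp (unpair.comp list_length)
  have hR : PrimrecPred R := by
    refine ((Primrec.eq.comp (primrec_root.comp h₁) (primrec_root.comp h₂)).and
      (primrecPred_forall_mem (primrec_children.comp h₁) ?_)).or
      (primrecPred_exists_mem (primrec_children.comp h₂) ?_)
    · exact Primrec.eq.comp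
        ((list_getD false).comp fst (Primrec₂.natPair.comp snd (h₂.comp fst))) (const true)
    · exact Primrec.eq.comp
        ((list_getD false).comp fst (Primrec₂.natPair.comp (h₁.comp fst) snd)) (const true)
  have key : Primrec₂ fun (_ : Unit) (z : ℕ) => decide (TLe z.unpair.1 z.unpair.2) := by
    refine nat_strong_rec _ (g := fun _ l => some (decide (R l)))
      (option_some.comp (hR.decide.comp snd)) fun _ n => ?_
    have hget : ∀ m < n, ((List.range n).map fun z : ℕ =>
        decide (TLe z.unpair.1 z.unpair.2)).getD m false = decide (TLe m.unpair.1 m.unpair.2) := by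
      intro m hm
      simp [List.getD_eq_getElem?_getD, hm]
    have hn : Nat.pair n.unpair.1 n.unpair.2 = n := Nat.pair_unpair n
    refine congrArg some (decide_eq_decide.2 ?_)
    simp only [R, List.length_map, List.length_range]
    rw [tle_iff]
    refine or_congr (and_congr_right fun _ => forall₂_congr fun s hs => ?_)
      (exists_congr fun s => and_congr_right fun hs => ?_)
    -- Replacing one component by a child lowers the code of the pair, so the answer is in the list
    -- and the default `false` is not read.
    · rw [hget _ (by conv_rhs => rw [← hn]
                     exact Nat.pair_lt_pair_left _ (lt_of_mem_children hs))]
      simp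
    · rw [hget _ (by conv_rhs => rw [← hn]
                     exact Nat.pair_lt_pair_right _ (lt_of_mem_children hs))]
      simp
  refine (PrimrecPred.comp (p := fun z : ℕ => TLe z.unpair.1 z.unpair.2)
    (Primrec.primrecPred (key.comp (const ()) .id)) (Primrec₂.natPair.comp fst snd)).of_eq ?_
  simp

variable {α : Type*} [Primcodable α]

theorem primrecPred_sLt {p : α → PosetCode} {i j : α → ℕ} (hp : Primrec p) (hi : Primrec i)
    (hj : Primrec j) : PrimrecPred fun a => SLt (p a) (i a) (j a) :=
  (primrecPred_mem (hi.pair hj) (snd.comp hp)).and (Primrec.eq.comp hi hj).not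

theorem primrec_corank : Primrec₂ corank :=
  list_length.comp (primrec_filter (list_range.comp (fst.comp fst))
    (primrecPred_sLt (fst.comp fst) (snd.comp fst) snd))

theorem primrec_above {p : α → PosetCode} {L : α → List ℕ} {i : α → ℕ} (hp : Primrec p)
    (hL : Primrec L) (hi : Primrec i) : Primrec fun a => above (p a) (L a) (i a) :=
  primrec_filter hL (primrecPred_sLt (hp.comp fst) (hi.comp fst) (primrec_root.comp snd))

theorem primrec_treesBelow : Primrec₂ treesBelow := by
  let step : PosetCode → ℕ × List ℕ → List ℕ := fun p q =>
    q.2 ++ ((List.range p.1).filter fun i => corank p i = q.1).flatMap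
      fun i => (above p q.2 i).sublists'.map (node i)
  have hstep : Primrec₂ step := by
    refine list_append.comp (snd.comp snd) (list_flatMap ?_ (list_map ?_ ?_))
    · exact primrec_filter (list_range.comp (fst.comp fst))
        (Primrec.eq.comp (primrec_corank.comp (fst.comp fst) snd) (fst.comp (snd.comp fst)))
    · exact primrec_sublists'.comp
        (primrec_above (fst.comp fst) (snd.comp (snd.comp fst)) snd)
    · exact primrec_node.comp (snd.comp fst) snd
  refine (nat_rec (const []) hstep).of_eq fun p h => ?_
  induction h with
  | zero => rfl
  | succ h ih => rw [treesBelow, ← ih]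

theorem primrec_trees : Primrec trees := primrec_treesBelow.comp .id fst

end Trees

/-! ### Computing presentations -/

section Presentations

open Primrec

/-- A presentation of a list of lists of numbers, ordered by inclusion. -/
def familyCode (X : List (List ℕ)) : PosetCode :=
  (X.length, ((List.range X.length).flatMap fun i =>
    (List.range X.length).map fun j => (i, j)).filter
    fun q => ∀ t ∈ X.getD q.1 [], t ∈ X.getD q.2 [])

theorem primrec_familyCode : Primrec familyCode := by
  refine list_length.pair (primrec_filter (list_flatMap (list_range.comp list_length)
    (list_map (list_range.comp (list_length.comp fst)) ((snd.comp fst).pair snd))) ?_)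
  exact primrecPred_forall_mem ((list_getD []).comp fst (fst.comp snd))
    (primrecPred_mem snd ((list_getD []).comp (fst.comp fst) (snd.comp (snd.comp fst))))

theorem presents_familyCode {L : List ℕ} (hL : L.Nodup) {X : List (List ℕ)} (hX : X.Nodup)
    (hXL : ∀ S ∈ X, S.Sublist L) {F : Set (Set ℕ)}
    (hF : ∀ T, T ∈ F ↔ ∃ S ∈ X, {t | t ∈ S} = T) : Presents (familyCode X) F := by
  let f : Fin X.length → F := fun i => ⟨{t | t ∈ X[i]}, (hF _).2 ⟨_, List.getElem_mem _, rfl⟩⟩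
  have hf : Function.Bijective f := by
    constructor
    · intro i j hij
      have h : ∀ t, t ∈ X[i] ↔ t ∈ X[j] := fun t =>
        Set.ext_iff.1 (congrArg (fun T : F => (T : Set ℕ)) hij) t
      -- As `L` has no repetitions, a sublist is determined by its set of members.
      have key : ∀ S ∈ X, S = L.filter (· ∈ S) := fun S hS => by
        have h₁ : S.Sublist (L.filter (· ∈ S)) := by
          have h₂ := (hXL S hS).filter (· ∈ S)
          rwa [List.filter_eq_self.2 (by simp)] at h₂
        exact h₁.eq_of_length_le
          ((hL.filter _).subperm fun t ht => by simpa using (List.mem_filter.1 ht).2).length_le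
      have : X[i] = X[j] := by
        rw [key X[i] (List.getElem_mem _), key X[j] (List.getElem_mem _)]
        exact List.filter_congr fun t _ => decide_eq_decide.2 (h t)
      exact Fin.val_injective ((hX.getElem_inj_iff).1 this)
    · rintro ⟨T, hT⟩
      obtain ⟨S, hS, rfl⟩ := (hF T).1 hT
      obtain ⟨i, hi, rfl⟩ := List.getElem_of_mem hS
      exact ⟨⟨i, hi⟩, rfl⟩
  refine ⟨Equiv.ofBijective f hf, fun i j => ?_⟩
  have hi : (i : ℕ) < X.length := i.2
  have hj : (j : ℕ) < X.length := j.2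
  simp only [familyCode, List.mem_filter, List.mem_flatMap, List.mem_map, List.mem_range]
  simp only [hi, hj, Prod.mk.injEq, List.getD_eq_getElem?_getD, List.getElem?_eq_getElem,
    Option.getD_some, decide_eq_true_eq]
  exact ⟨fun h => ⟨⟨i, hi, j, hj, rfl, rfl⟩, h⟩, fun h => h.2⟩

open Classical in
/-- The sublists of trees that are closed downwards. -/
noncomputable def lowerLists (p : PosetCode) : List (List ℕ) :=
  (trees p).sublists'.filter fun S => ∀ t ∈ S, ∀ s ∈ trees p, TLe s t → s ∈ S

open Classical in
theorem primrec_lowerLists : Primrec lowerLists := by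
  refine primrec_filter (primrec_sublists'.comp primrec_trees) (primrecPred_forall_mem snd
    (primrecPred_forall_mem (primrec_trees.comp (fst.comp fst)) (primrecPred_imp ?_ ?_)))
  · exact primrecRel_tle.comp snd (snd.comp fst)
  · exact primrecPred_mem snd (snd.comp (fst.comp fst))

theorem mem_lowerLists {p : PosetCode} {S : List ℕ} :
    S ∈ lowerLists p ↔ S.Sublist (trees p) ∧ {t | t ∈ S} ∈ lowerTrees p := by
  simp only [lowerLists, List.mem_filter, List.mem_sublists', decide_eq_true_eq]
  exact and_congr_right fun h => ⟨fun h' => ⟨fun t ht => h.subset ht, h'⟩, fun h' => h'.2⟩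

theorem nodup_lowerLists (p : PosetCode) : (lowerLists p).Nodup :=
  (List.nodup_sublists'.2 (nodup_trees p)).filter _

theorem exists_mem_lowerLists {p : PosetCode} {T : Set ℕ} (hT : T ∈ lowerTrees p) :
    ∃ S ∈ lowerLists p, {t | t ∈ S} = T := by
  classical
  have h : {t | t ∈ (trees p).filter (· ∈ T)} = T := by
    ext t
    simpa using fun ht => hT.1 ht
  exact ⟨_, mem_lowerLists.2 ⟨List.filter_sublist, by rw [h]; exact hT⟩, h⟩

theorem presents_familyCode_filter {p : PosetCode} {F : Set (Set ℕ)} {q : List ℕ → Prop}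
    [DecidablePred q] (hF : ∀ S : List ℕ,
      {t | t ∈ S} ∈ F ↔ {t | t ∈ S} ∈ lowerTrees p ∧ q S)
    (hF' : ∀ T ∈ F, T ∈ lowerTrees p) :
    Presents (familyCode ((lowerLists p).filter (q ·))) F := by
  refine presents_familyCode (nodup_trees p) ((nodup_lowerLists p).filter _)
    (fun S hS => (mem_lowerLists.1 (List.mem_filter.1 hS).1).1) fun T => ?_
  constructor
  · intro hT
    obtain ⟨S, hS, rfl⟩ := exists_mem_lowerLists (hF' T hT)
    exact ⟨S, List.mem_filter.2 ⟨hS, by simpa using ((hF S).1 hT).2⟩, rfl⟩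
  · rintro ⟨S, hS, rfl⟩
    obtain ⟨h₁, h₂⟩ := List.mem_filter.1 hS
    exact (hF S).2 ⟨(mem_lowerLists.1 h₁).2, by simpa using h₂⟩

/-- A presentation of the non-empty downward closed sets of reduced trees. -/
noncomputable def starCode (p : PosetCode) : PosetCode :=
  familyCode ((lowerLists p).filter fun S => S ≠ [])

/-- A presentation of the downward closed sets of reduced trees in which every label occurs. -/
noncomputable def fullCode (p : PosetCode) : PosetCode :=
  familyCode ((lowerLists p).filter fun S => ∀ i < p.1, node i [] ∈ S)

theorem primrec_starCode : Primrec starCode :=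
  primrec_familyCode.comp (primrec_filter primrec_lowerLists (Primrec.eq.comp snd (const [])).not)

theorem primrec_fullCode : Primrec fullCode :=
  primrec_familyCode.comp (primrec_filter primrec_lowerLists (primrecPred_forall_lt
    (fst.comp fst) (primrecPred_mem (primrec_node.comp snd (const [])) (snd.comp fst))))

theorem presents_starCode (p : PosetCode) : Presents (starCode p) (starTrees p) := by
  refine presents_familyCode_filter (fun S => and_congr_right fun _ => ?_) fun T hT => hT.1
  rw [ne_eq, List.eq_nil_iff_forall_not_mem, not_forall_not]
  rfl

theorem presents_fullCode (p : PosetCode) :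
    Presents (fullCode p) (fullLowerTrees p : Set (Set ℕ)) :=
  presents_familyCode_filter (fun _ => Iff.rfl) fun _ hT => hT.1

theorem Presents.of_orderIso {p : PosetCode} {X Y : Type} [PartialOrder X] [PartialOrder Y]
    (h : Presents p X) (f : X ≃o Y) : Presents p Y := by
  obtain ⟨e, he⟩ := h
  exact ⟨e.trans f.toEquiv, fun i j => by simpa using he i j⟩

end Presentations

/-! ### Deciding isomorphism of coded posets -/

section Isomorphism

open Primrec

/-- The lists of length `m` of numbers less than `n`. -/
def words (n : ℕ) : ℕ → List (List ℕ)
  | 0 => [[]]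
  | m + 1 => (words n m).flatMap fun l => (List.range n).map fun i => i :: l

theorem mem_words {n m : ℕ} {l : List ℕ} : l ∈ words n m ↔ l.length = m ∧ ∀ i ∈ l, i < n := by
  induction m generalizing l with
  | zero => simp +contextual [words, List.length_eq_zero_iff]
  | succ m ih =>
    simp only [words, List.mem_flatMap, ih, List.mem_map, List.mem_range]
    constructor
    · rintro ⟨l, ⟨rfl, h⟩, i, hi, rfl⟩
      simpa [hi] using h
    · rintro ⟨h, h'⟩
      cases l with
      | nil => simp at h
      | cons i l =>
        exact ⟨l, ⟨by simpa using h, fun j hj => h' j (by simp [hj])⟩, i, h' i (by simp), rfl⟩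

theorem primrec_words : Primrec₂ words := by
  let step : ℕ → ℕ × List (List ℕ) → List (List ℕ) := fun n q =>
    q.2.flatMap fun l => (List.range n).map fun i => i :: l
  have hstep : Primrec₂ step := list_flatMap (snd.comp snd)
    (list_map (list_range.comp (fst.comp fst)) (list_cons.comp snd (snd.comp fst)).to₂).to₂
  refine (nat_rec (const [[]]) hstep).of_eq ?_
  intro n m
  induction m with
  | zero => rfl
  | succ m ih => rw [words, ← ih]

/-- The coded posets are isomorphic: a word lists the images of the elements. -/
def IsoCode (q : PosetCode × PosetCode) : Prop :=
  q.1.1 = q.2.1 ∧ ∃ l ∈ words q.1.1 q.1.1, ∀ i < q.1.1, ∀ j < q.1.1,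
    ((i, j) ∈ q.1.2 ↔ (l.getD i 0, l.getD j 0) ∈ q.2.2)

theorem primrecPred_isoCode : PrimrecPred IsoCode := by
  have h₁ : Primrec fun q : PosetCode × PosetCode => q.1.1 := fst.comp fst
  refine (Primrec.eq.comp h₁ (fst.comp snd)).and (primrecPred_exists_mem (primrec_words.comp h₁ h₁)
    (primrecPred_forall_lt (h₁.comp fst) (primrecPred_forall_lt (h₁.comp (fst.comp fst))
      (primrecPred_iff (primrecPred_mem ?_ ?_) (primrecPred_mem (.pair ?_ ?_) ?_)))))
  · exact (snd.comp fst).pair snd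
  · exact snd.comp (fst.comp (fst.comp (fst.comp fst)))
  · exact (list_getD 0).comp (snd.comp (fst.comp fst)) (snd.comp fst)
  · exact (list_getD 0).comp (snd.comp (fst.comp fst)) snd
  · exact snd.comp (snd.comp (fst.comp (fst.comp fst)))

theorem isoCode_iff {p q : PosetCode} {X Y : Type} [PartialOrder X] [PartialOrder Y]
    (hp : Presents p X) (hq : Presents q Y) : IsoCode (p, q) ↔ Nonempty (X ≃o Y) := by
  obtain ⟨e, he⟩ := hp
  obtain ⟨e', he'⟩ := hq
  obtain ⟨n, r⟩ := p
  obtain ⟨m, r'⟩ := q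
  dsimp only at e e' he he'
  constructor
  · rintro ⟨rfl : n = m, l, hl, h⟩
    obtain ⟨rfl, hl⟩ := mem_words.1 hl
    dsimp only at hl h e e' he he'
    let f : Fin l.length → Fin l.length := fun i => ⟨l[i], hl _ (List.getElem_mem _)⟩
    have hf : ∀ i j, e i ≤ e j ↔ e' (f i) ≤ e' (f j) := fun i j => by
      rw [he, he', h i i.2 j j.2]
      simp [f]
    -- Reflecting the order forces injectivity, and equal finite sizes give bijectivity; words need
    -- not be tested for being permutations.
    have hinj : Function.Injective f := fun i j hij => by
      have h₁ := (hf i j).2 (by rw [hij])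
      have h₂ := (hf j i).2 (by rw [hij])
      exact e.injective (h₁.antisymm h₂)
    let g := Equiv.ofBijective f (Finite.injective_iff_bijective.1 hinj)
    exact ⟨⟨(e.symm.trans g).trans e', fun {x y} => by
      have := hf (e.symm x) (e.symm y)
      simp only [Equiv.apply_symm_apply] at this
      exact this.symm⟩⟩
  · rintro ⟨f⟩
    let g : Fin n ≃ Fin m := (e.trans f.toEquiv).trans e'.symm
    obtain rfl : n = m := by simpa using Fintype.card_congr g
    refine ⟨rfl, List.ofFn fun i => (g i : ℕ), mem_words.2 ⟨by simp, ?_⟩, fun i hi j hj => ?_⟩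
    · simp [List.mem_ofFn]
    · dsimp only at hi hj ⊢
      rw [← he ⟨i, hi⟩ ⟨j, hj⟩]
      have : ∀ i (hi : i < n), (List.ofFn fun i => (g i : ℕ)).getD i 0 = g ⟨i, hi⟩ := fun i hi => by
        simp [List.getD_eq_getElem?_getD, hi]
      rw [this i hi, this j hj, ← he']
      simp [g]

end Isomorphism

end TotRep

/-! ### Assembly: comparison through the common posets of lower sets -/

namespace TotRep

/-- Every bijection with `{0, …, k - 1}` presents a poset. -/
theorem exists_code {P : Type} [PartialOrder P] {k : ℕ} (c : P ≃ Fin k) :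
    ∃ r : List (ℕ × ℕ), ∀ i j : Fin k, c.symm i ≤ c.symm j ↔ ((i : ℕ), (j : ℕ)) ∈ r := by
  classical
  refine ⟨((Finset.univ.filter fun q : Fin k × Fin k => c.symm q.1 ≤ c.symm q.2).toList).map
    fun q => ((q.1 : ℕ), (q.2 : ℕ)), fun i j => ?_⟩
  simp only [List.mem_map, Finset.mem_toList, Finset.mem_filter, Finset.mem_univ, true_and,
    Prod.mk.injEq, Prod.exists]
  constructor
  · exact fun h => ⟨i, j, h, rfl, rfl⟩
  · rintro ⟨i', j', h, hi, hj⟩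
    rwa [← Fin.val_injective hi, ← Fin.val_injective hj]

theorem nonempty_orderIso_segments (A : Set (Set Baire)) [Finite A] [Nonempty A]
    (hA : ∀ U ∈ A, IsOpen U) (k : ℕ) [NeZero k] (c : A ≃ Fin k) :
    Nonempty (LStar A ≃o Set.Iic (hClass (unfolding c))) ∧
      Nonempty (LFull A ≃o Set.Icc (eClass k) (hClass (unfolding c))) := by
  obtain ⟨r, hr⟩ := exists_code c
  have h : Presents (k, r) A := ⟨c.symm, hr⟩
  obtain ⟨f⟩ := nonempty_lStar_orderIso hA h
  obtain ⟨g⟩ := nonempty_lFull_orderIso hA h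
  obtain ⟨f'⟩ := nonempty_Iic_orderIso hr h.valid
  obtain ⟨g'⟩ := nonempty_Icc_orderIso hr h.valid
  exact ⟨⟨f.trans f'.symm⟩, ⟨g.trans g'.symm⟩⟩

theorem isFiniteDistribLattice_reps (A : Set (Set Baire)) [Finite A] [Nonempty A]
    (hA : ∀ U ∈ A, IsOpen U) :
    IsFiniteDistribLattice (WithBot (LStar A)) ∧ IsFiniteDistribLattice (LFull A) := by
  obtain ⟨k, ⟨c⟩⟩ := Finite.exists_equiv_fin A
  obtain ⟨r, hr⟩ := exists_code c
  have h : Presents (k, r) A := ⟨c.symm, hr⟩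
  obtain ⟨f⟩ := nonempty_lStar_orderIso hA h
  obtain ⟨g⟩ := nonempty_lFull_orderIso hA h
  exact ⟨isFiniteDistribLattice_withBot_lStar f, isFiniteDistribLattice_lFull h.valid g⟩

theorem presents_reps (A : Set (Set Baire)) [Finite A] [Nonempty A] (hA : ∀ U ∈ A, IsOpen U)
    (p : PosetCode) (h : Presents p A) :
    Presents (starCode p) (LStar A) ∧ Presents (fullCode p) (LFull A) := by
  obtain ⟨f⟩ := nonempty_lStar_orderIso hA h
  obtain ⟨g⟩ := nonempty_lFull_orderIso hA h
  exact ⟨(presents_starCode p).of_orderIso f.symm, (presents_fullCode p).of_orderIso g.symm⟩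

end TotRep

theorem mainTheorem4 :
    -- the isomorphisms with segments of the poset of labeled forests, and the lattice property
    (∀ (A : Set (Set Baire)) [Finite A] [Nonempty A], (∀ U ∈ A, IsOpen U) →
      (∀ (k : ℕ) [NeZero k] (c : A ≃ Fin k),
        Nonempty (LStar A ≃o Set.Iic (hClass (unfolding c))) ∧
        Nonempty (LFull A ≃o Set.Icc (eClass k) (hClass (unfolding c)))) ∧
      IsFiniteDistribLattice (WithBot (LStar A)) ∧
      IsFiniteDistribLattice (LFull A)) ∧
    -- presentations of both posets are computable from a presentation of `(A; ⊆)`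
    (∃ fStar fFull : PosetCode → PosetCode, Computable fStar ∧ Computable fFull ∧
      ∀ (A : Set (Set Baire)) [Finite A] [Nonempty A], (∀ U ∈ A, IsOpen U) →
        ∀ p : PosetCode, Presents p A →
          Presents (fStar p) (LStar A) ∧ Presents (fFull p) (LFull A)) ∧
    -- the isomorphism relations are decidable from presentations of `(A; ⊆)` and `(B; ⊆)`
    (∃ dStar dFull : PosetCode × PosetCode → Bool, Computable dStar ∧ Computable dFull ∧
      ∀ (A B : Set (Set Baire)) [Finite A] [Nonempty A] [Finite B] [Nonempty B],
        (∀ U ∈ A, IsOpen U) → (∀ U ∈ B, IsOpen U) →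
        ∀ p q : PosetCode, Presents p A → Presents q B →
          (dStar (p, q) = true ↔ Nonempty (LStar A ≃o LStar B)) ∧
          (dFull (p, q) = true ↔ Nonempty (LFull A ≃o LFull B))) := by
  classical
  refine ⟨fun A _ _ hA => ⟨nonempty_orderIso_segments A hA, isFiniteDistribLattice_reps A hA⟩,
    ⟨starCode, fullCode, primrec_starCode.to_comp, primrec_fullCode.to_comp, presents_reps⟩,
    fun q => decide (IsoCode (starCode q.1, starCode q.2)),
    fun q => decide (IsoCode (fullCode q.1, fullCode q.2)), Primrec.to_comp ?_, Primrec.to_comp ?_,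
    fun A B _ _ _ _ hA hB p q hp hq => ?_⟩
  · exact (primrecPred_isoCode.comp ((primrec_starCode.comp .fst).pair
      (primrec_starCode.comp .snd))).decide
  · exact (primrecPred_isoCode.comp ((primrec_fullCode.comp .fst).pair
      (primrec_fullCode.comp .snd))).decide
  · obtain ⟨h₁, h₂⟩ := presents_reps A hA p hp
    obtain ⟨h₃, h₄⟩ := presents_reps B hB q hq
    simp only [decide_eq_true_eq]
    exact ⟨isoCode_iff h₁ h₃, isoCode_iff h₂ h₄⟩
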